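/- For $X=X_0X_1X_2\dots\in 2^\omega$ write $0.X=\sum_{i\ge 0}X_i2^{-i-1}$ and let $X\upharpoonright n$ be the word of the first $n$ bits of $X$. Let $\alpha\in 2^\omega$ be Martin-Löf random with respect to the uniform measure on $2^\omega$, and let $p=0.\alpha$. For a stake function $S:2^{<\omega}\to[-1,1]\cap\mathbb{Q}$, let $\mathcal M_S:2^{<\omega}\to\mathbb{R}$ be defined by $\mathcal M_S(\varepsilon)=1$ and $$\mathcal M_S(\sigma 1)=\mathcal M_S(\sigma)\Big(1-|S(\sigma)|+\tfrac{|S(\sigma)|}{p}1_{\{S(\sigma)\ge 0\}}\Big),\qquad \mathcal M_S(\sigma 0)=\mathcal M_S(\sigma)\Big(1-|S(\sigma)|+\tfrac{|S(\sigma)|}{1-p}1_{\{S(\sigma)<0\}}\Big).$$ A sequence $X\in 2^\omega$ is called $\mu_\alpha$-Hippocratic computably random if for every total computable $S$ (computable without access to $\alpha$) the sequence $(\mathcal M_S(X\upharpoonright n))_n$ is bounded. It is called $\alpha$-computably random if $(\mathcal M(X\upharpoonright n))_n$ is bounded for every total function $\mathcal M:2^{<\omega}\to\mathbb{R}^{\ge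 0}$ that is computable with oracle $\alpha$ and satisfies $\mathcal M(\sigma)=p\,\mathcal M(\sigma 1)+(1-p)\,\mathcal M(\sigma 0)$ for all $\sigma$. Then there is a sequence $Q\in 2^\omega$ such that 1. $Q$ is computable in polynomial time from $\alpha$: some Turing machine with oracle $\alpha$ computes the bit $Q_n$ from $n$ (given in unary) in a number of steps that is bounded by a polynomial in $n$; in particular $Q$ is computable from $\alpha$; 2. $Q$ is $\mu_\alpha$-Hippocratic computably random; 3. $Q$ is not $\alpha$-computably random. Consequently Hippocratic computable randomness is strictly weaker than classical computable randomness for the bias $p$: the set of $\alpha$-computably random sequences is a proper subset of the set of $\mu_\alpha$-Hippocratic computably random sequences. -/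

import Mathlib

namespace Hippocratic

/-! ### Sequences, prefixes, the real `0.X`, and the fair-coin measure

A sequence in `2^ω` is a function `ℕ → Bool`; its bits are numbered from `0`. Finite words are
lists of bits, read from left to right. -/

/-- The word formed by the first `n` bits of `X`. -/
def initSeg (X : ℕ → Bool) (n : ℕ) : List Bool := (List.range n).map X

/-- The real number with binary expansion `0.X`. -/
noncomputable def toReal (X : ℕ → Bool) : ℝ :=
  ∑' i : ℕ, (if X i then (1 : ℝ) else 0) * (1 / 2) ^ (i + 1)

/-- The uniform (fair-coin) probability measure on `2^ω`. -/
noncomputable def fairCoin : MeasureTheory.Measure (ℕ → Bool) :=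
  MeasureTheory.Measure.infinitePi fun _ : ℕ => (PMF.uniformOfFintype Bool).toMeasure

/-! ### Martin-Löf randomness -/

/-- `(U n)` is a uniformly `Σ⁰₁` sequence of subsets of `2^ω`: for a recursively enumerable set `W`
of pairs, `U n` is the set of the sequences that have a prefix `σ` with `(n, σ) ∈ W`. -/
def UniformlySigma01 (U : ℕ → Set (ℕ → Bool)) : Prop :=
  ∃ W : Set (ℕ × List Bool), REPred (fun x => x ∈ W) ∧
    ∀ n, U n = {X | ∃ k, (n, initSeg X k) ∈ W}

/-- `X` is Martin-Löf random with respect to the fair-coin measure. -/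
def MartinLofRandom (X : ℕ → Bool) : Prop :=
  ∀ U : ℕ → Set (ℕ → Bool), UniformlySigma01 U →
    (∀ n, fairCoin (U n) ≤ (2 : ENNReal)⁻¹ ^ n) → X ∉ ⋂ n, U n

/-! ### Oracle computability -/

/-- The sequence `A`, as an oracle. -/
def oracle (A : ℕ → Bool) : ℕ →. ℕ := fun n => Part.some (A n).toNat

/-- The sequence `X` is computable from the sequence `A` (Turing reducibility). -/
def ComputableFrom (A X : ℕ → Bool) : Prop := ComputableIn {oracle A} X

/-- `f` is a computable rational-valued function on words: numerators and (positive)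
denominators of its values are computable. -/
def ComputableRat (f : List Bool → ℚ) : Prop :=
  ∃ a b d : List Bool → ℕ, Computable a ∧ Computable b ∧ Computable d ∧
    ∀ σ, f σ = ((a σ : ℚ) - b σ) / (d σ + 1)

/-- `f` is a real-valued function on words that is computable from the oracle `A`: a rational
approximation of `f σ` with error at most `2 ^ (-n)` is computable from `σ`, `n` and `A`. -/
def ComputableRealFrom (A : ℕ → Bool) (f : List Bool → ℝ) : Prop :=
  ∃ a b d : List Bool × ℕ → ℕ, ComputableIn {oracle A} a ∧ ComputableIn {oracle A} b ∧
    ComputableIn {oracle A} d ∧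
    ∀ σ n, |f σ - ((a (σ, n) : ℝ) - b (σ, n)) / (d (σ, n) + 1)| ≤ (1 / 2) ^ n

/-! ### Martingales: the classical and the Hippocratic notion of computable randomness -/

/-- `M` is a `p`-martingale (with values in the nonnegative reals). -/
def IsMartingale (p : ℝ) (M : List Bool → ℝ) : Prop :=
  (∀ σ, 0 ≤ M σ) ∧ ∀ σ, M σ = p * M (σ ++ [true]) + (1 - p) * M (σ ++ [false])

/-- `M` is bounded along the prefixes of `X`. -/
def BoundedAlong (M : List Bool → ℝ) (X : ℕ → Bool) : Prop :=
  BddAbove (Set.range fun n => M (initSeg X n))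

/-- `X` is computably random in the classical sense for the Bernoulli measure with parameter
`p = 0.A`: every total `p`-martingale that is computable from `A` is bounded along `X`. -/
def ComputablyRandom (A X : ℕ → Bool) : Prop :=
  ∀ M : List Bool → ℝ, IsMartingale (toReal A) M → ComputableRealFrom A M → BoundedAlong M X

/-- The factor by which the capital is multiplied when the fraction `|s|` of it is staked, on `1` if
`0 ≤ s` and on `0` if `s < 0`, and the outcome of a `p`-biased coin toss is `b`. -/
noncomputable def factor (p : ℝ) (s : ℚ) : Bool → ℝ
  | true => 1 - |(s : ℝ)| + |(s : ℝ)| / p * (if 0 ≤ s then 1 else 0)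
  | false => 1 - |(s : ℝ)| + |(s : ℝ)| / (1 - p) * (if s < 0 then 1 else 0)

/-- The `p`-martingale that arises from the stake function `S`. -/
noncomputable def capital (S : List Bool → ℚ) (p : ℝ) (σ : List Bool) : ℝ :=
  σ.reverseRecOn 1 fun τ b m => m * factor p (S τ) b

theorem capital_nil (S : List Bool → ℚ) (p : ℝ) : capital S p [] = 1 := by
  simp [capital]

theorem capital_concat (S : List Bool → ℚ) (p : ℝ) (σ : List Bool) (b : Bool) :
    capital S p (σ ++ [b]) = capital S p σ * factor p (S σ) b := by
  simp [capital]

/-- `X` is Hippocratic computably random for the Bernoulli measure with parameter `p`: every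
`p`-martingale that arises from a total stake function with rational values in `[-1, 1]`,
computable without an oracle, is bounded along `X`. -/
def HippocraticComputablyRandom (p : ℝ) (X : ℕ → Bool) : Prop :=
  ∀ S : List Bool → ℚ, (∀ σ, |S σ| ≤ 1) → ComputableRat S → BoundedAlong (capital S p) X

/-! ### Polynomial time computation from an oracle -/

/-- A deterministic Turing machine with a read-only oracle tape, a read-only input tape and `k` work
tapes. All tapes are indexed by `ℤ`. A cell of the oracle tape holds a bit or is blank (`none`), a
cell of the input tape holds a stroke (`true`) or is blank (`false`), a cell of a work tape holds a
symbol from the finite alphabet `Γ`. In a state `q` with `out q = some b` the machine has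
halted with output `b`. In any other state, `δ` gives, from the state and the scanned symbols, the
next state, the moves of the oracle head and of the input head, and for each work tape the symbol to
write and the move of its head; a move is `-1` (left), `0` (stay) or `1` (right). -/
structure OracleTM where
  State : Type
  finite_State : Finite State
  Γ : Type
  finite_Γ : Finite Γ
  blank : Γ
  k : ℕ
  start : State
  out : State → Option Bool
  δ : State → Option Bool → Bool → (Fin k → Γ) →
    State × SignType × SignType × (Fin k → Γ × SignType)

namespace OracleTM

/-- A configuration: the state, the positions of the oracle head, of the input head and of the heads
on the work tapes, and the contents of the work tapes. -/
structure Cfg (M : OracleTM) where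
  state : M.State
  oraclePos : ℤ
  inputPos : ℤ
  workPos : Fin M.k → ℤ
  work : Fin M.k → ℤ → M.Γ

/-- The oracle tape: bit `i` of `A` is in cell `i`, for `i ≥ 0`; the other cells are blank. -/
def oracleTape (A : ℕ → Bool) (z : ℤ) : Option Bool := if 0 ≤ z then some (A z.toNat) else none

/-- The input tape for the input `n`, written in unary: strokes in the cells `0, …, n - 1`. -/
def inputTape (n : ℕ) (z : ℤ) : Bool := decide (0 ≤ z ∧ z < n)

variable (M : OracleTM)

/-- The initial configuration: all heads on cell `0`, and blank work tapes. -/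
def init : M.Cfg where
  state := M.start
  oraclePos := 0
  inputPos := 0
  workPos := fun _ => 0
  work := fun _ _ => M.blank

/-- One step of computation with oracle `A` on input `n`; halted configurations do not change. -/
def step (A : ℕ → Bool) (n : ℕ) (c : M.Cfg) : M.Cfg :=
  match M.out c.state with
  | some _ => c
  | none =>
    let r := M.δ c.state (oracleTape A c.oraclePos) (inputTape n c.inputPos)
      fun i => c.work i (c.workPos i)
    { state := r.1
      oraclePos := c.oraclePos + (r.2.1 : ℤ)
      inputPos := c.inputPos + (r.2.2.1 : ℤ)
      workPos := fun i => c.workPos i + ((r.2.2.2 i).2 : ℤ)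
      work := fun i => Function.update (c.work i) (c.workPos i) (r.2.2.2 i).1 }

/-- With oracle `A` and input `n`, the machine halts after at most `t` steps, with output `b`. -/
def OutputsWithin (A : ℕ → Bool) (n t : ℕ) (b : Bool) : Prop :=
  M.out (((M.step A n)^[t] M.init).state) = some b

end OracleTM

/-- `X` is computable in polynomial time from `A`: some oracle machine, with oracle `A` and input
`n`, outputs bit `n` of `X` in a number of steps that is polynomial in `n`. -/
def PolyTimeComputableFrom (A X : ℕ → Bool) : Prop :=
  ∃ (M : OracleTM) (P : Polynomial ℕ), ∀ n, M.OutputsWithin A n (P.eval n) (X n)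

end Hippocratic

namespace Hippocratic

/-! ### Words and sequences -/

/-! `Q` is a sequence of coin tosses simulated from `α`: toss `k` is `1` when a fresh block of `k`
bits of `α`, read as a number, is below the first `k` bits of `α`. Over a uniform `α`, and given the
bits before the block, this is a coin whose bias is exactly the truncation of `p` to `k` binary
digits, hence within `2 ^ (-k)` of `p`. `Q` is not `α`-computably random, because a gambler with
oracle `α` knows each toss in advance (`not_computablyRandom_coinToss`). A gambler without the
oracle bets on the tosses alone. If paid by the truncated biases, the capital is a nonnegative
supermartingale under the uniform measure, with values computable from finitely many bits. By
Ville's inequality (`blockAverage_exceed_le`) the events "the capital exceeds `2 ^ j`" form a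
Martin-Löf test, so the capital stays bounded at the random `α`
(`MartinLofRandom.tossCapital_bounded`). Replacing the truncated biases by `p` costs a factor at
most `1 + 2 ^ (-k) / (1 - p)` at toss `k`, and the product of these converges
(`hippocratic_coinToss`). The inclusion of the two classes holds because the capital depends
continuously on the bias, with an explicit modulus (`computableRealFrom_capital`). Blocks start at
`k * (k + 1)`: they are disjoint, lie beyond the first `k` bits, and are reached by a simple machine
in quadratic time. -/

theorem initSeg_succ (X : ℕ → Bool) (n : ℕ) : initSeg X (n + 1) = initSeg X n ++ [X n] := by
  simp [initSeg, List.range_succ]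

@[simp] theorem length_initSeg (X : ℕ → Bool) (n : ℕ) : (initSeg X n).length = n := by
  simp [initSeg]

theorem initSeg_congr {X Y : ℕ → Bool} {n : ℕ} (h : ∀ i < n, X i = Y i) :
    initSeg X n = initSeg Y n := by
  simpa [initSeg] using h

/-- The word `w`, followed by zeros. -/
def extend (w : List Bool) (i : ℕ) : Bool := w.getD i false

theorem extend_initSeg (X : ℕ → Bool) {n i : ℕ} (h : i < n) : extend (initSeg X n) i = X i := by
  simp [extend, initSeg, h]

theorem initSeg_extend (w : List Bool) : initSeg (extend w) w.length = w := by
  apply List.ext_getElem <;> simp +contextual [initSeg, extend]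

/-- The number with binary digits `X s, …, X (s + k - 1)`, the most significant one first. -/
def digits (X : ℕ → Bool) (s : ℕ) : ℕ → ℕ
  | 0 => 0
  | k + 1 => 2 * digits X s k + (X (s + k)).toNat

theorem digits_congr {X Y : ℕ → Bool} {s k : ℕ} (h : ∀ i, s ≤ i → i < s + k → X i = Y i) :
    digits X s k = digits Y s k := by
  induction k with
  | zero => rfl
  | succ k ih =>
    rw [digits, digits, ih fun i h1 h2 => h i h1 (by omega), h (s + k) (by omega) (by omega)]

theorem digits_lt (X : ℕ → Bool) (s k : ℕ) : digits X s k < 2 ^ k := by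
  induction k with
  | zero => simp [digits]
  | succ k ih =>
    have := Bool.toNat_le (X (s + k))
    rw [digits, pow_succ]
    omega

/-- The definition recurses on the least significant digit, whereas averaging over a block fixes its
first, most significant bit first. -/
theorem digits_succ_left (X : ℕ → Bool) (s k : ℕ) :
    digits X s (k + 1) = (X s).toNat * 2 ^ k + digits X (s + 1) k := by
  induction k with
  | zero => simp [digits]
  | succ k ih =>
    rw [digits, ih, digits, pow_succ, show s + (k + 1) = s + 1 + k by ring]
    ring

/-- A gap of at least `1` doubles to at least `2`, which the next digit cannot close. This lets the
machine stop at the first difference. -/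
theorem digits_lt_of_le {X : ℕ → Bool} {s t i k : ℕ} (hik : i ≤ k)
    (h : digits X s i < digits X t i) : digits X s k < digits X t k := by
  induction k, hik using Nat.le_induction with
  | base => exact h
  | succ k _ ih =>
    have := Bool.toNat_le (X (s + k))
    rw [digits, digits]
    omega

/-! ### Computability of products and of sequences of digits -/

section Computability

variable {β σ : Type*} [Primcodable β] [Primcodable σ]

theorem computable_extend {w : β → List Bool} {i : β → ℕ} (hw : Computable w)
    (hi : Computable i) : Computable fun x => extend (w x) (i x) :=
  (Primrec.list_getD false).to_comp.comp hw hi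

theorem computable_add {f g : β → ℕ} (hf : Computable f) (hg : Computable g) :
    Computable fun x => f x + g x := Primrec.nat_add.to_comp.comp hf hg

theorem computable_sub {f g : β → ℕ} (hf : Computable f) (hg : Computable g) :
    Computable fun x => f x - g x := Primrec.nat_sub.to_comp.comp hf hg

theorem computable_mul {f g : β → ℕ} (hf : Computable f) (hg : Computable g) :
    Computable fun x => f x * g x := Primrec.nat_mul.to_comp.comp hf hg

theorem computable_prod_range {f : β → ℕ → ℕ} {n : β → ℕ} (hf : Computable₂ f)
    (hn : Computable n) : Computable fun x => ∏ k ∈ Finset.range (n x), f x k := by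
  refine (Computable.nat_rec (h := fun x p => p.2 * f x p.1) hn (Computable.const 1) ?_).of_eq
    fun x => ?_
  · exact computable_mul (Computable.snd.comp Computable.snd)
      (hf.comp Computable.fst (Computable.fst.comp Computable.snd))
  · induction n x with
    | zero => rfl
    | succ k ih => rw [Finset.prod_range_succ, ← ih]

theorem computable_two_pow {n : β → ℕ} (hn : Computable n) : Computable fun x => 2 ^ n x :=
  (computable_prod_range (f := fun _ _ => 2) (Computable.const 2) hn).of_eq fun x => by simp

theorem computable_digits {X : β → ℕ → Bool} {s k : β → ℕ} (hX : Computable₂ X)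
    (hs : Computable s) (hk : Computable k) : Computable fun x => digits (X x) (s x) (k x) := by
  refine (Computable.nat_rec (h := fun x p => 2 * p.2 + (X x (s x + p.1)).toNat) hk
    (Computable.const 0) ?_).of_eq fun x => ?_
  · refine computable_add (computable_mul (Computable.const 2)
      (Computable.snd.comp Computable.snd)) ?_
    exact (Primrec.dom_bool Bool.toNat).to_comp.comp (hX.comp Computable.fst
      (computable_add (hs.comp Computable.fst) (Computable.fst.comp Computable.snd)))
  · induction k x with
    | zero => rfl
    | succ k ih => rw [digits, ← ih]

theorem computable_initSeg {X : β → ℕ → Bool} {k : β → ℕ} (hX : Computable₂ X)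
    (hk : Computable k) : Computable fun x => initSeg (X x) (k x) := by
  refine (Computable.nat_rec (h := fun x p => p.2 ++ [X x p.1]) hk (Computable.const []) ?_).of_eq
    fun x => ?_
  · exact Computable.list_concat.comp (Computable.snd.comp Computable.snd)
      (hX.comp Computable.fst (Computable.fst.comp Computable.snd))
  · induction k x with
    | zero => rfl
    | succ k ih => rw [initSeg_succ, ← ih]

theorem computable_decide_lt {f g : β → ℕ} (hf : Computable f) (hg : Computable g) :
    Computable fun x => decide (f x < g x) :=
  Primrec.nat_lt.decide.to_comp.comp hf hg

/-! ### Oracle computations that read a computable number of bits -/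

theorem recursiveIn_initSeg (A : ℕ → Bool) :
    Nat.RecursiveIn {oracle A} fun n => Part.some (Encodable.encode (initSeg A n)) := by
  have concat : Computable fun q : (ℕ × ℕ × List Bool) × ℕ => q.1.2.2 ++ [q.2.bodd] :=
    Computable.list_concat.comp (Computable.snd.comp (Computable.snd.comp Computable.fst))
      (Computable.nat_bodd.comp Computable.snd)
  have hconcat : Nat.RecursiveIn {oracle A} _ := Nat.Partrec.recursiveIn concat
  -- The step function of `prec` receives the code of (parameter, (stage, previous value)); the
  -- oracle is queried at the stage.
  have bit : Nat.RecursiveIn {oracle A} fun n => Part.some (A n.unpair.2.unpair.1).toNat := by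
    refine ((Nat.RecursiveIn.oracle (oracle A) (Set.mem_singleton _)).comp
      (Nat.RecursiveIn.left.comp Nat.RecursiveIn.right)).of_eq fun n => ?_
    change (Part.bind (Part.bind (Part.some _) fun m : ℕ => Part.some m.unpair.1) _) = _
    rw [Part.bind_some]
    exact Part.bind_some _ _
  have step := hconcat.comp ((Nat.Partrec.recursiveIn Nat.Partrec.some).pair bit)
  have main := (Nat.RecursiveIn.prec (Nat.Partrec.recursiveIn (f := fun _ => Part.some 0)
    (Nat.Partrec.of_primrec (Nat.Primrec.const 0))) step).comp
    ((Nat.Partrec.recursiveIn Nat.Partrec.some).pair (Nat.Partrec.recursiveIn Nat.Partrec.some))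
  refine main.of_eq fun n => ?_
  simp only [Part.bind_eq_bind, Part.map_eq_map, Part.map_some, Seq.seq, Part.bind_some,
    Nat.unpair_pair]
  suffices h : ∀ m, (Nat.rec (Part.some 0) _ m : Part ℕ) =
      Part.some (Encodable.encode (initSeg A m)) from h n
  intro m
  induction m with
  | zero => rfl
  | succ m ih =>
    have hb : (A m).toNat.bodd = A m := by cases A m <;> rfl
    simp only [ih]
    simp [initSeg_succ, hb]

/-- An oracle computation with computably bounded use is an ordinary computation on an initial
segment; every oracle algorithm below is presented in this form. -/
theorem computableIn_of_initSeg {A : ℕ → Bool} {f : β × List Bool → σ} {g : β → ℕ}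
    (hf : Computable f) (hg : Computable g) :
    ComputableIn {oracle A} fun x => f (x, initSeg A (g x)) := by
  have h1 : Nat.RecursiveIn {oracle A} _ := Nat.Partrec.recursiveIn hf
  have h2 : Nat.RecursiveIn {oracle A} _ := Nat.Partrec.recursiveIn hg
  have h3 := h1.comp ((Nat.Partrec.recursiveIn Nat.Partrec.some).pair
    ((recursiveIn_initSeg A).comp h2))
  refine h3.of_eq fun n => ?_
  cases h : (Encodable.decode n : Option β) with
  | none => simp [Seq.seq]
  | some x => simp [h, Seq.seq]

end Computability

/-! ### The factors of a martingale as fractions -/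

/-- The numerator of the factor for the stake `(a - b) / (d + 1)` and the bias `P / L`. -/
def factorNum (a b d P L : ℕ) (c : Bool) : ℕ :=
  (d + 1 - (a - b + (b - a))) * cond c P (L - P) + cond c (a - b) (b - a) * L

/-- The denominator of the factor for a stake with denominator `d + 1` and the bias `P / L`. -/
def factorDen (d P L : ℕ) (c : Bool) : ℕ := (d + 1) * cond c P (L - P)

/-- With truncated subtraction, `a - b` and `b - a` are the positive and negative parts of the
stake's numerator: their sum is its absolute value, and each pays on one outcome. Bias zero is
harmless on outcome `0`. -/
theorem factor_eq_div {a b d P L : ℕ} {c : Bool} {s : ℚ} (hs : s = ((a : ℚ) - b) / (d + 1))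
    (hs1 : |s| ≤ 1) (hP : c = true → 0 < P) (hL : P < L) :
    factor (P / L) s c = (factorNum a b d P L c : ℝ) / factorDen d P L c := by
  have hd : (0 : ℝ) < d + 1 := by positivity
  have hL0 : (0 : ℝ) < L := by exact_mod_cast (Nat.zero_le P).trans_lt hL
  have hLP : (0 : ℝ) < L - P := by rw [sub_pos]; exact_mod_cast hL
  have hsR : (s : ℝ) = ((a : ℝ) - b) / (d + 1) := by rw [hs]; push_cast; rfl
  have hs1R : |(s : ℝ)| ≤ 1 := by exact_mod_cast hs1
  rw [hsR, abs_div, abs_of_pos hd, div_le_one hd] at hs1R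
  rcases le_or_gt b a with hab | hab
  · have hs0 : 0 ≤ s := by
      rw [hs]; exact div_nonneg (sub_nonneg.2 (by exact_mod_cast hab)) (by positivity)
    have hab' : (0 : ℝ) ≤ a - b := sub_nonneg.2 (by exact_mod_cast hab)
    rw [abs_of_nonneg hab'] at hs1R
    have hle : a - b ≤ d + 1 := by
      have : ((a - b : ℕ) : ℝ) ≤ (d + 1 : ℕ) := by rw [Nat.cast_sub hab]; push_cast; exact hs1R
      exact_mod_cast this
    have h0 : b - a = 0 := by omega
    cases c
    · simp only [factor, factorNum, factorDen, hs0.not_gt, h0, hsR, abs_div, abs_of_pos hd,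
        abs_of_nonneg hab', cond_false, add_zero, Nat.cast_mul]
      push_cast [Nat.cast_sub hle, Nat.cast_sub hab, Nat.cast_sub hL.le]
      field_simp
      simp
    · have hP0 : (0 : ℝ) < P := by exact_mod_cast hP rfl
      simp only [factor, factorNum, factorDen, hs0, h0, hsR, abs_div, abs_of_pos hd,
        abs_of_nonneg hab', cond_true, add_zero, Nat.cast_mul, Nat.cast_sub hle, Nat.cast_sub hab,
        Nat.cast_add, Nat.cast_one]
      field_simp
      simp
  · have hs0 : s < 0 := by
      rw [hs]; exact div_neg_of_neg_of_pos (sub_neg.2 (by exact_mod_cast hab)) (by positivity)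
    have hab' : (a : ℝ) - b < 0 := sub_neg.2 (by exact_mod_cast hab)
    rw [abs_of_neg hab'] at hs1R
    have hle : b - a ≤ d + 1 := by
      have : ((b - a : ℕ) : ℝ) ≤ (d + 1 : ℕ) := by
        rw [Nat.cast_sub hab.le]; push_cast; linarith
      exact_mod_cast this
    have h0 : a - b = 0 := by omega
    cases c
    · have h1 : (1 : ℝ) - P / L = (L - P) / L := by field_simp
      simp only [factor, factorNum, factorDen, hs0, h0, hsR, abs_div, abs_of_pos hd,
        abs_of_neg hab', cond_false, zero_add, Nat.cast_mul, Nat.cast_sub hle, Nat.cast_sub hab.le,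
        Nat.cast_sub hL.le, Nat.cast_add, Nat.cast_one, h1]
      field_simp
      simp
      ring
    · have hP0 : (0 : ℝ) < P := by exact_mod_cast hP rfl
      simp only [factor, factorNum, factorDen, hs0.not_ge, h0, hsR, abs_div, abs_of_pos hd,
        abs_of_neg hab', cond_true, zero_add, Nat.cast_mul, Nat.cast_sub hle, Nat.cast_sub hab.le,
        Nat.cast_add, Nat.cast_one]
      field_simp
      simp
      ring

theorem factorDen_pos {d P L : ℕ} {c : Bool} (hP : c = true → 0 < P) (hL : P < L) :
    0 < factorDen d P L c := by
  cases c
  · simpa [factorDen] using hL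
  · simpa [factorDen] using hP rfl

section Computability

variable {β : Type*} [Primcodable β]

theorem computable_factorNum {a b d P L : β → ℕ} {c : β → Bool} (ha : Computable a)
    (hb : Computable b) (hd : Computable d) (hP : Computable P) (hL : Computable L)
    (hc : Computable c) :
    Computable fun x => factorNum (a x) (b x) (d x) (P x) (L x) (c x) :=
  computable_add
    (computable_mul (computable_sub (computable_add hd (Computable.const 1))
      (computable_add (computable_sub ha hb) (computable_sub hb ha)))
      (Computable.cond hc hP (computable_sub hL hP)))
    (computable_mul (Computable.cond hc (computable_sub ha hb) (computable_sub hb ha)) hL)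

theorem computable_factorDen {d P L : β → ℕ} {c : β → Bool} (hd : Computable d)
    (hP : Computable P) (hL : Computable L) (hc : Computable c) :
    Computable fun x => factorDen (d x) (P x) (L x) (c x) :=
  computable_mul (computable_add hd (Computable.const 1))
    (Computable.cond hc hP (computable_sub hL hP))

end Computability

/-! ### Basic properties of factors and capitals -/

theorem factor_nonneg {p : ℝ} (h0 : 0 ≤ p) (h1 : p ≤ 1) {s : ℚ} (hs : |s| ≤ 1) (c : Bool) :
    0 ≤ factor p s c := by
  have hs' : 0 ≤ 1 - |(s : ℝ)| := sub_nonneg.2 (by exact_mod_cast hs)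
  cases c
  · exact add_nonneg hs' (mul_nonneg (div_nonneg (abs_nonneg _) (sub_nonneg.2 h1))
      (by split_ifs <;> norm_num))
  · exact add_nonneg hs' (mul_nonneg (div_nonneg (abs_nonneg _) h0) (by split_ifs <;> norm_num))

theorem factor_average {p : ℝ} (h0 : 0 < p) (h1 : p < 1) (s : ℚ) :
    p * factor p s true + (1 - p) * factor p s false = 1 := by
  have h1' : (1 - p) ≠ 0 := (sub_pos.2 h1).ne'
  rcases le_or_gt 0 s with hs | hs
  · simp only [factor, hs, hs.not_gt, if_true, if_false]
    field_simp
    ring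
  · simp only [factor, hs, hs.not_ge, if_true, if_false]
    field_simp
    ring

/-- This includes `p = 0`, where the quotients in `factor` are not meaningful. -/
theorem factor_average_le {p : ℝ} (h0 : 0 ≤ p) (h1 : p < 1) (s : ℚ) :
    p * factor p s true + (1 - p) * factor p s false ≤ 1 := by
  rcases h0.eq_or_lt with rfl | h0
  · have := abs_nonneg (s : ℝ)
    simp only [factor]
    split_ifs <;> simp
  · exact (factor_average h0 h1 s).le

theorem capital_initSeg (S : List Bool → ℚ) (p : ℝ) (X : ℕ → Bool) (n : ℕ) :
    capital S p (initSeg X n) =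
      ∏ k ∈ Finset.range n, factor p (S (initSeg X k)) (X k) := by
  induction n with
  | zero => simp [initSeg, capital_nil]
  | succ n ih => rw [initSeg_succ, capital_concat, ih, Finset.prod_range_succ]

theorem isMartingale_capital {p : ℝ} (h0 : 0 < p) (h1 : p < 1) {S : List Bool → ℚ}
    (hS : ∀ σ, |S σ| ≤ 1) : IsMartingale p (capital S p) := by
  refine ⟨fun σ => ?_, fun σ => ?_⟩
  · rw [← initSeg_extend σ, capital_initSeg]
    exact Finset.prod_nonneg fun k _ => factor_nonneg h0.le h1.le (hS _) _
  · rw [capital_concat, capital_concat]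
    linear_combination -capital S p σ * factor_average h0 h1 (S σ)

/-! ### Dependence of the factors on the bias -/

/-- Underestimating the bias only raises the payoff `1 / q` on outcome `1`. On outcome `0` the
payoffs have ratio `(1 - q) / (1 - p) = 1 + (p - q) / (1 - p)`. -/
theorem factor_le_of_bias_le {p q δ : ℝ} (hq : 0 ≤ q) (hqp : q ≤ p) (hp : p < 1)
    (hδ : p - q ≤ δ) {s : ℚ} (hs : |s| ≤ 1) {c : Bool} (hc : c = true → 0 < q) :
    factor p s c ≤ (1 + δ / (1 - p)) * factor q s c := by
  have hp' : 0 < 1 - p := sub_pos.2 hp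
  have hq' : 0 < 1 - q := by linarith
  have hδ0 : 0 ≤ δ := by linarith
  have hs' : 0 ≤ 1 - |(s : ℝ)| := sub_nonneg.2 (by exact_mod_cast hs)
  have hfac : 1 ≤ 1 + δ / (1 - p) := by
    have : 0 ≤ δ / (1 - p) := by positivity
    linarith
  cases c
  · have key : |(s : ℝ)| / (1 - p) ≤ (1 + δ / (1 - p)) * (|(s : ℝ)| / (1 - q)) := by
      have : 1 / (1 - p) ≤ (1 + δ / (1 - p)) * (1 / (1 - q)) := by
        rw [show (1 + δ / (1 - p)) * (1 / (1 - q)) = (1 - p + δ) / (1 - q) * (1 / (1 - p)) by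
          field_simp]
        exact le_mul_of_one_le_left (by positivity) ((one_le_div hq').2 (by linarith))
      calc |(s : ℝ)| / (1 - p) = |(s : ℝ)| * (1 / (1 - p)) := by ring
        _ ≤ |(s : ℝ)| * ((1 + δ / (1 - p)) * (1 / (1 - q))) := by gcongr
        _ = _ := by ring
    simp only [factor]
    rw [mul_add]
    refine add_le_add (le_mul_of_one_le_left hs' hfac) ?_
    rw [← mul_assoc]
    exact mul_le_mul_of_nonneg_right key (by split_ifs <;> norm_num)
  · have hq0 := hc rfl
    refine le_trans ?_ (le_mul_of_one_le_left (factor_nonneg hq (hqp.trans hp.le) hs _) hfac)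
    simp only [factor]
    gcongr

/-- The payoffs are reciprocals, and `x ↦ 1 / x` is `B ^ 2`-Lipschitz on `[1 / B, ∞)`. -/
theorem abs_factor_sub_le {p q B : ℝ} (hB : 0 < B) (hp : 1 / B ≤ p) (hp1 : p ≤ 1 - 1 / B)
    (hq : 1 / B ≤ q) (hq1 : q ≤ 1 - 1 / B) {s : ℚ} (hs : |s| ≤ 1) (c : Bool) :
    |factor p s c - factor q s c| ≤ B ^ 2 * |p - q| := by
  have hs1 : |(s : ℝ)| ≤ 1 := by exact_mod_cast hs
  have key : ∀ x y : ℝ, 1 / B ≤ x → 1 / B ≤ y → ∀ i : ℝ, |i| ≤ 1 →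
      |(|(s : ℝ)| / x * i - |(s : ℝ)| / y * i)| ≤ B ^ 2 * |x - y| := by
    intro x y hx hy i hi
    have hx0 : 0 < x := lt_of_lt_of_le (by positivity) hx
    have hy0 : 0 < y := lt_of_lt_of_le (by positivity) hy
    have hxB : 1 / x ≤ B := (one_div_le hB hx0).1 hx
    have hyB : 1 / y ≤ B := (one_div_le hB hy0).1 hy
    have e : |(s : ℝ)| / x * i - |(s : ℝ)| / y * i =
        |(s : ℝ)| * i * ((1 / x) * (1 / y) * (y - x)) := by field_simp
    rw [e, abs_mul, abs_mul, abs_mul, abs_abs, abs_sub_comm y x,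
      abs_of_pos (show 0 < 1 / x * (1 / y) by positivity)]
    calc |(s : ℝ)| * |i| * (1 / x * (1 / y) * |x - y|) ≤ 1 * 1 * (B * B * |x - y|) := by gcongr
      _ = _ := by ring
  cases c
  · have := key (1 - p) (1 - q) (by linarith) (by linarith) (if s < 0 then 1 else 0)
      (by split_ifs <;> norm_num)
    rw [show (1 - p) - (1 - q) = q - p by ring, abs_sub_comm q p] at this
    simpa only [factor, add_sub_add_left_eq_sub] using this
  · simpa only [factor, add_sub_add_left_eq_sub] using
      key p q hp hq (if 0 ≤ s then 1 else 0) (by split_ifs <;> norm_num)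

theorem factor_le {p B : ℝ} (hB : 1 ≤ B) (hp : 1 / B ≤ p) (hp1 : p ≤ 1 - 1 / B) {s : ℚ}
    (hs : |s| ≤ 1) (c : Bool) : factor p s c ≤ B := by
  have hs1 : |(s : ℝ)| ≤ 1 := by exact_mod_cast hs
  have key : ∀ x : ℝ, 1 / B ≤ x → ∀ i : ℝ, i ≤ 1 → 1 - |(s : ℝ)| + |(s : ℝ)| / x * i ≤ B := by
    intro x hx i hi
    have hx0 : 0 < x := lt_of_lt_of_le (by positivity) hx
    have hxB : 1 / x ≤ B := (one_div_le (by positivity) hx0).1 hx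
    calc 1 - |(s : ℝ)| + |(s : ℝ)| / x * i ≤ 1 - |(s : ℝ)| + |(s : ℝ)| / x * 1 := by gcongr
      _ = (1 - |(s : ℝ)|) * 1 + |(s : ℝ)| * (1 / x) := by ring
      _ ≤ (1 - |(s : ℝ)|) * B + |(s : ℝ)| * B := by
        gcongr
      _ = B := by ring
  cases c
  · exact key (1 - p) (by linarith) _ (by split_ifs <;> norm_num)
  · exact key p hp _ (by split_ifs <;> norm_num)

theorem abs_capital_sub_le {p q B : ℝ} (hB : 1 ≤ B) (hp : 1 / B ≤ p) (hp1 : p ≤ 1 - 1 / B)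
    (hq : 1 / B ≤ q) (hq1 : q ≤ 1 - 1 / B) {S : List Bool → ℚ} (hS : ∀ σ, |S σ| ≤ 1)
    (X : ℕ → Bool) (n : ℕ) :
    |capital S p (initSeg X n) - capital S q (initSeg X n)| ≤ n * B ^ (n + 1) * |p - q| := by
  have hB0 : 0 < B := by linarith
  have hB' : 0 < 1 / B := by positivity
  simp only [capital_initSeg]
  have bound : ∀ n, ∏ k ∈ Finset.range n, factor q (S (initSeg X k)) (X k) ≤ B ^ n := fun n => by
    refine (Finset.prod_le_prod (fun k _ => factor_nonneg (by linarith) (by linarith) (hS _) _)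
      fun k _ => factor_le hB hq hq1 (hS _) _).trans ?_
    simp
  induction n with
  | zero => simp
  | succ n ih =>
    rw [Finset.prod_range_succ, Finset.prod_range_succ]
    set x := ∏ k ∈ Finset.range n, factor p (S (initSeg X k)) (X k)
    set y := ∏ k ∈ Finset.range n, factor q (S (initSeg X k)) (X k)
    have hy : |y| ≤ B ^ n := by
      rw [abs_of_nonneg (Finset.prod_nonneg fun k _ =>
        factor_nonneg (by linarith) (by linarith) (hS _) _)]
      exact bound n
    set f := factor p (S (initSeg X n)) (X n) with hf
    set g := factor q (S (initSeg X n)) (X n)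
    have hf' : |f| ≤ B := by
      rw [abs_of_nonneg (factor_nonneg (by linarith) (by linarith) (hS _) _)]
      exact factor_le hB hp hp1 (hS _) _
    have hfg : |f - g| ≤ B ^ 2 * |p - q| := abs_factor_sub_le hB0 hp hp1 hq hq1 (hS _) _
    calc |x * f - y * g| = |(x - y) * f + y * (f - g)| := by ring_nf
      _ ≤ |x - y| * |f| + |y| * |f - g| := by
        rw [← abs_mul, ← abs_mul]; exact abs_add_le _ _
      _ ≤ n * B ^ (n + 1) * |p - q| * B + B ^ n * (B ^ 2 * |p - q|) := by gcongr
      _ = _ := by push_cast; ring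

/-! ### Averages over blocks of bits -/

/-- The average of `F` over the sequences that differ from `X` at most in the bits
`m, …, m + L - 1`. -/
noncomputable def blockAverage (m : ℕ) : ℕ → ((ℕ → Bool) → ℝ) → (ℕ → Bool) → ℝ
  | 0, F, X => F X
  | L + 1, F, X => (blockAverage (m + 1) L F (Function.update X m false) +
      blockAverage (m + 1) L F (Function.update X m true)) / 2

theorem agree_update {X Y : ℕ → Bool} {m : ℕ} {b : Bool}
    (h : ∀ i < m + 1, Y i = Function.update X m b i) : ∀ i < m, Y i = X i := fun i hi => by
  rw [h i (by omega), Function.update_of_ne (by omega)]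

theorem blockAverage_le {m L : ℕ} {F G : (ℕ → Bool) → ℝ} {X : ℕ → Bool}
    (h : ∀ Y, (∀ i < m, Y i = X i) → F Y ≤ G Y) :
    blockAverage m L F X ≤ blockAverage m L G X := by
  induction L generalizing m X with
  | zero => exact h X fun _ _ => rfl
  | succ L ih =>
    have h' (b : Bool) := ih (X := Function.update X m b) fun Y hY => h Y (agree_update hY)
    simp only [blockAverage]
    linarith [h' false, h' true]

theorem blockAverage_congr {m L : ℕ} {F G : (ℕ → Bool) → ℝ} {X : ℕ → Bool}
    (h : ∀ Y, (∀ i < m, Y i = X i) → F Y = G Y) :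
    blockAverage m L F X = blockAverage m L G X :=
  (blockAverage_le fun Y hY => (h Y hY).le).antisymm (blockAverage_le fun Y hY => (h Y hY).ge)

theorem blockAverage_const (m L : ℕ) (a : ℝ) (X : ℕ → Bool) :
    blockAverage m L (fun _ => a) X = a := by
  induction L generalizing m X with
  | zero => rfl
  | succ L ih => simp [blockAverage, ih]

/-- The tower property of conditional expectation. -/
theorem blockAverage_add (m K L : ℕ) (F : (ℕ → Bool) → ℝ) (X : ℕ → Bool) :
    blockAverage m (K + L) F X = blockAverage m K (blockAverage (m + K) L F) X := by
  induction K generalizing m X with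
  | zero => simp [blockAverage]
  | succ K ih =>
    rw [Nat.add_right_comm, blockAverage, blockAverage, ih, ih, Nat.add_right_comm m 1 K]
    rfl

theorem blockAverage_of_agree {m L : ℕ} {F : (ℕ → Bool) → ℝ} {X : ℕ → Bool}
    (h : ∀ Y, (∀ i < m, Y i = X i) → F Y = F X) : blockAverage m L F X = F X := by
  rw [blockAverage_congr h, blockAverage_const]

/-- A uniform `k`-bit number is below `P` with probability `P / 2 ^ k`. In the induction on the
first bit, the threshold for the remaining bits is `P` after a `0` and the truncated `P - 2 ^ k`
after a `1`. -/
theorem blockAverage_digits_lt (m k P : ℕ) (hP : P ≤ 2 ^ k) (a b : ℝ) (X : ℕ → Bool) :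
    blockAverage m k (fun Y => if digits Y m k < P then a else b) X =
      P / (2 ^ k : ℕ) * a + (1 - P / (2 ^ k : ℕ)) * b := by
  induction k generalizing m P X with
  | zero =>
    obtain rfl | rfl : P = 0 ∨ P = 1 := by simp at hP; omega
    · simp [blockAverage]
    · simp [blockAverage, digits]
  | succ k ih =>
    have hk : (0 : ℝ) < (2 ^ k : ℕ) := by positivity
    have key (c : Bool) : blockAverage (m + 1) k
        (fun Y => if digits Y m (k + 1) < P then a else b) (Function.update X m c) =
        blockAverage (m + 1) k
        (fun Y => if digits Y (m + 1) k < P - c.toNat * 2 ^ k then a else b)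
          (Function.update X m c) := by
      refine blockAverage_congr fun Y hY => ?_
      have : Y m = c := by rw [hY m (by omega), Function.update_self]
      rw [digits_succ_left, this]
      congr 1
      exact propext (by omega)
    have hall (c : Bool) : blockAverage (m + 1) k
        (fun Y => if digits Y (m + 1) k < 2 ^ k then a else b) (Function.update X m c) = a := by
      rw [ih _ _ le_rfl, div_self hk.ne']
      ring
    rw [blockAverage, key, key]
    simp only [Bool.toNat_false, Bool.toNat_true, zero_mul, one_mul, Nat.sub_zero]
    have h2 : ((2 ^ (k + 1) : ℕ) : ℝ) = 2 * (2 ^ k : ℕ) := by rw [pow_succ]; push_cast; ring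
    rcases le_or_gt P (2 ^ k) with h | h
    · rw [ih _ P h, Nat.sub_eq_zero_of_le h, ih _ 0 (Nat.zero_le _), h2]
      field_simp
      push_cast
      ring
    · have : blockAverage (m + 1) k (fun Y => if digits Y (m + 1) k < P then a else b)
          (Function.update X m false) = a := by
        refine (blockAverage_congr fun Y _ => ?_).trans (hall false)
        rw [if_pos ((digits_lt _ _ _).trans h), if_pos (digits_lt _ _ _)]
      rw [this, ih _ (P - 2 ^ k) (by rw [pow_succ] at hP; omega), h2, Nat.cast_sub h.le]
      field_simp
      ring

/-! ### Averages and the fair-coin measure -/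

theorem fairCoin_cylinder (X : ℕ → Bool) (m : ℕ) :
    fairCoin {Y | ∀ i < m, Y i = X i} = 2⁻¹ ^ m := by
  have : {Y : ℕ → Bool | ∀ i < m, Y i = X i} =
      Set.pi (Finset.range m : Set ℕ) fun i => {X i} := by
    ext Y; simp [Set.mem_pi]
  rw [this, fairCoin, MeasureTheory.Measure.infinitePi_pi _ (by simp)]
  simp

/-- Splits the cylinder in halves until all relevant bits are fixed. Subadditivity suffices for an
upper bound, so no measurability of `A` is needed. -/
theorem fairCoin_inter_cylinder_le {A : Set (ℕ → Bool)} {m L : ℕ} {X : ℕ → Bool}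
    (hA : ∀ Y Z : ℕ → Bool, (∀ i < m + L, Y i = Z i) → Y ∈ A → Z ∈ A) :
    fairCoin ({Y | ∀ i < m, Y i = X i} ∩ A) ≤
      ENNReal.ofReal ((1 / 2) ^ m * blockAverage m L (A.indicator 1) X) := by
  induction L generalizing m X with
  | zero =>
    by_cases hX : X ∈ A
    · refine (MeasureTheory.measure_mono Set.inter_subset_left).trans ?_
      rw [fairCoin_cylinder, blockAverage, Set.indicator_of_mem hX, Pi.one_apply, mul_one,
        ENNReal.ofReal_pow (by norm_num)]
      simp
    · have : {Y : ℕ → Bool | ∀ i < m, Y i = X i} ∩ A = ∅ :=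
        Set.eq_empty_of_forall_notMem fun Y h => hX (hA Y X h.1 h.2)
      simp [this]
  | succ L ih =>
    have hsub : {Y : ℕ → Bool | ∀ i < m, Y i = X i} ∩ A ⊆
        ({Y | ∀ i < m + 1, Y i = Function.update X m false i} ∩ A) ∪
        ({Y | ∀ i < m + 1, Y i = Function.update X m true i} ∩ A) := by
      rintro Y ⟨hY, hYA⟩
      have : ∀ i < m + 1, Y i = Function.update X m (Y m) i := fun i hi => by
        rcases eq_or_ne i m with rfl | hne
        · simp
        · rw [Function.update_of_ne hne, hY i (by omega)]
      cases hb : Y m <;> rw [hb] at this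
      · exact Or.inl ⟨this, hYA⟩
      · exact Or.inr ⟨this, hYA⟩
    have hnn (b : Bool) :
        0 ≤ blockAverage (m + 1) L (A.indicator 1) (Function.update X m b) := by
      rw [← blockAverage_const (m + 1) L 0 (Function.update X m b)]
      exact blockAverage_le fun Y _ => Set.indicator_nonneg (fun _ _ => zero_le_one) Y
    have ih' (b : Bool) := ih (m := m + 1) (X := Function.update X m b)
      fun Y Z h => hA Y Z fun i hi => h i (by omega)
    refine (MeasureTheory.measure_mono hsub).trans <| (MeasureTheory.measure_union_le _ _).trans <|
      (add_le_add (ih' false) (ih' true)).trans ?_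
    rw [← ENNReal.ofReal_add (mul_nonneg (by positivity) (hnn _))
      (mul_nonneg (by positivity) (hnn _)), blockAverage]
    refine ENNReal.ofReal_le_ofReal (le_of_eq ?_)
    ring

theorem fairCoin_le_blockAverage {A : Set (ℕ → Bool)} {L : ℕ}
    (hA : ∀ Y Z : ℕ → Bool, (∀ i < L, Y i = Z i) → Y ∈ A → Z ∈ A) (X : ℕ → Bool) :
    fairCoin A ≤ ENNReal.ofReal (blockAverage 0 L (A.indicator 1) X) := by
  simpa using fairCoin_inter_cylinder_le (m := 0) (L := L) (X := X) (by simpa using hA)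

/-! ### The sequence computed from the oracle -/

/-- The position at which the bits of the oracle for the `k`-th coin toss begin. -/
def blockStart (k : ℕ) : ℕ := k * (k + 1)

/-- The `k`-th coin toss: a block of `k` fresh bits is compared with the first `k` bits. -/
def coinToss (X : ℕ → Bool) (k : ℕ) : Bool :=
  decide (digits X (blockStart k) k < digits X 0 k)

/-- The bias of the `k`-th coin toss. -/
noncomputable def tossBias (X : ℕ → Bool) (k : ℕ) : ℝ := digits X 0 k / (2 ^ k : ℕ)

/-- The capital of the gambler with stakes `S` on the coin tosses, paid according to the bias of
each toss. -/
noncomputable def tossCapital (S : List Bool → ℚ) (X : ℕ → Bool) (n : ℕ) : ℝ :=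
  ∏ k ∈ Finset.range n, factor (tossBias X k) (S (initSeg (coinToss X) k)) (coinToss X k)

/-- Outcome `1` never occurs with bias zero, so the conventional value of a quotient by zero in
`factor` plays no role there. -/
theorem digits_pos_of_coinToss {X : ℕ → Bool} {k : ℕ} (h : coinToss X k = true) :
    0 < digits X 0 k :=
  (Nat.zero_le _).trans_lt (of_decide_eq_true h)

theorem tossBias_nonneg (X : ℕ → Bool) (k : ℕ) : 0 ≤ tossBias X k := by
  unfold tossBias; positivity

theorem tossBias_lt_one (X : ℕ → Bool) (k : ℕ) : tossBias X k < 1 := by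
  rw [tossBias, div_lt_one (by positivity)]
  exact_mod_cast digits_lt X 0 k

theorem tossBias_congr {X Y : ℕ → Bool} {k : ℕ} (h : ∀ i < k, X i = Y i) :
    tossBias X k = tossBias Y k := by
  rw [tossBias, tossBias, digits_congr fun i _ hi => h i (by omega)]

/-- Block `k` ends before `(k + 1) ^ 2`, so the first `n` tosses use only the first `n ^ 2` bits,
all of which precede block `n`. -/
theorem coinToss_congr {X Y : ℕ → Bool} {n k : ℕ} (hk : k < n)
    (h : ∀ i < n * n, X i = Y i) : coinToss X k = coinToss Y k := by
  have h1 : (k + 1) * (k + 1) ≤ n * n := Nat.mul_le_mul hk hk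
  have h2 : k * (k + 1) + k < (k + 1) * (k + 1) := by ring_nf; omega
  rw [coinToss, coinToss, digits_congr (Y := Y) fun i _ hi => h i (by unfold blockStart at hi; omega),
    digits_congr (Y := Y) fun i _ hi => h i (by nlinarith)]

theorem tossCapital_congr {S : List Bool → ℚ} {X Y : ℕ → Bool} {n : ℕ}
    (h : ∀ i < n * n, X i = Y i) : tossCapital S X n = tossCapital S Y n := by
  refine Finset.prod_congr rfl fun k hk => ?_
  have hk := Finset.mem_range.1 hk
  rw [coinToss_congr hk h, tossBias_congr fun i hi => h i (by nlinarith),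
    initSeg_congr fun i hi => coinToss_congr (hi.trans hk) h]

theorem tossCapital_nonneg {S : List Bool → ℚ} (hS : ∀ σ, |S σ| ≤ 1) (X : ℕ → Bool) (n : ℕ) :
    0 ≤ tossCapital S X n :=
  Finset.prod_nonneg fun _ _ =>
    factor_nonneg (tossBias_nonneg _ _) (tossBias_lt_one _ _).le (hS _) _

/-- The supermartingale property: the bits before block `n` fix the capital, the stake and the bias,
and the block then acts as a coin with exactly this bias. The averaged bits are the `n` bits of the
block and the `n + 2` unused ones before the next block. -/
theorem blockAverage_tossCapital_le {S : List Bool → ℚ} (hS : ∀ σ, |S σ| ≤ 1) (X : ℕ → Bool)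
    (n : ℕ) (c : ℝ) (hc : 0 ≤ c) : blockAverage (blockStart n) (n + (n + 2))
      (fun Y => c * tossCapital S Y (n + 1)) X ≤ c * tossCapital S X n := by
  have hsq : n * n ≤ blockStart n := Nat.mul_le_mul_left n (Nat.le_succ n)
  have hn : n ≤ blockStart n := by unfold blockStart; nlinarith
  set s := S (initSeg (coinToss X) n) with hs
  have key : ∀ Y : ℕ → Bool, (∀ i < blockStart n, Y i = X i) →
      blockAverage (blockStart n + n) (n + 2) (fun Y => c * tossCapital S Y (n + 1)) Y =
      if digits Y (blockStart n) n < digits X 0 n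
        then c * (tossCapital S X n * factor (tossBias X n) s true)
        else c * (tossCapital S X n * factor (tossBias X n) s false) := by
    intro Y hY
    rw [blockAverage_of_agree]
    · rw [tossCapital, Finset.prod_range_succ, ← tossCapital,
        tossCapital_congr (Y := X) fun i hi => hY i (by omega),
        tossBias_congr (Y := X) fun i hi => hY i (by omega),
        initSeg_congr (Y := coinToss X) fun i hi =>
          coinToss_congr hi fun i hi => hY i (by omega), ← hs, coinToss,
        digits_congr (s := 0) (Y := X) fun i _ hi => hY i (by omega)]
      split_ifs with h <;> simp [h]
    · intro Z hZ
      have h1 : tossCapital S Z n = tossCapital S Y n :=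
        tossCapital_congr fun i hi => hZ i (by omega)
      have h2 : coinToss Z n = coinToss Y n := by
        rw [coinToss, coinToss, digits_congr (Y := Y) fun i _ hi => hZ i hi,
          digits_congr (s := 0) (Y := Y) fun i _ hi => hZ i (by omega)]
      rw [tossCapital, Finset.prod_range_succ, ← tossCapital, h1, h2,
        tossBias_congr (Y := Y) fun i hi => hZ i (by omega),
        initSeg_congr (Y := coinToss Y) fun i hi =>
          coinToss_congr hi fun i hi => hZ i (by omega), tossCapital, tossCapital,
        Finset.prod_range_succ]
  rw [blockAverage_add, blockAverage_congr key,
    blockAverage_digits_lt _ _ _ (digits_lt _ _ _).le, ← tossBias]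
  calc _ = c * tossCapital S X n * (tossBias X n * factor (tossBias X n) s true +
        (1 - tossBias X n) * factor (tossBias X n) s false) := by ring
    _ ≤ c * tossCapital S X n * 1 :=
      mul_le_mul_of_nonneg_left
        (factor_average_le (tossBias_nonneg _ _) (tossBias_lt_one _ _) _)
        (mul_nonneg hc (tossCapital_nonneg hS X n))
    _ = _ := mul_one _

/-- A form of Ville's maximal inequality. -/
theorem blockAverage_exceed_le {S : List Bool → ℚ} (hS : ∀ σ, |S σ| ≤ 1) {c : ℝ} (hc : 0 < c)
    (r n : ℕ) (X : ℕ → Bool) :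
    blockAverage (blockStart n) (blockStart (n + r) - blockStart n)
      ({Y | ∃ m ≤ r, c < tossCapital S Y (n + m)}.indicator 1) X ≤ c⁻¹ * tossCapital S X n := by
  induction r generalizing n X with
  | zero =>
    simp only [Nat.add_zero, Nat.sub_self, blockAverage]
    by_cases h : c < tossCapital S X n
    · rw [Set.indicator_of_mem (by simpa using h), Pi.one_apply]
      exact ((one_le_inv_mul₀ hc).2 h.le)
    · rw [Set.indicator_of_notMem (by simpa using h)]
      exact mul_nonneg (inv_pos.2 hc).le (tossCapital_nonneg hS X n)
  | succ r ih =>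
    by_cases hX : c < tossCapital S X n
    · calc _ ≤ blockAverage (blockStart n) (blockStart (n + (r + 1)) - blockStart n)
              (fun _ => 1) X :=
            blockAverage_le fun Y _ => Set.indicator_le_self' (fun _ _ => zero_le_one) Y
        _ = 1 := blockAverage_const _ _ _ _
        _ ≤ _ := (one_le_inv_mul₀ hc).2 hX.le
    -- Here time `n` contributes nothing to the event, so the inductive bound from time `n + 1`
    -- applies to each continuation; averaging it over block `n` does not increase it.
    · have h1 : blockStart (n + 1) = blockStart n + (n + (n + 2)) := by
        unfold blockStart; ring
      have h2 : blockStart (n + 1) ≤ blockStart (n + 1 + r) := by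
        exact Nat.mul_le_mul (by omega) (by omega)
      have h3 : blockStart (n + (r + 1)) - blockStart n =
          n + (n + 2) + (blockStart (n + 1 + r) - blockStart (n + 1)) := by
        rw [show n + (r + 1) = n + 1 + r by ring]; omega
      rw [h3, blockAverage_add]
      refine le_trans (blockAverage_le fun Y hY => ?_)
        (blockAverage_tossCapital_le hS X n c⁻¹ (inv_pos.2 hc).le)
      rw [← h1]
      refine le_trans ?_ (ih (n + 1) Y)
      refine blockAverage_le fun Z hZ => ?_
      by_cases hZE : Z ∈ {Y | ∃ m ≤ r + 1, c < tossCapital S Y (n + m)}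
      · refine (Set.indicator_of_mem hZE _).le.trans (Set.indicator_of_mem ?_ _).ge
        obtain ⟨m, hm, hlt⟩ := hZE
        cases m with
        | zero =>
          refine absurd ?_ hX
          have hsq : n * n ≤ blockStart n := Nat.mul_le_mul_left n (Nat.le_succ n)
          rwa [add_zero, tossCapital_congr (Y := X) fun i hi => by
            rw [hZ i (by omega), hY i (by omega)]] at hlt
        | succ m => exact ⟨m, by omega, by rwa [Nat.add_right_comm, Nat.add_assoc]⟩
      · rw [Set.indicator_of_notMem hZE]
        exact Set.indicator_nonneg (fun _ _ => zero_le_one) Z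

/-- The finite-horizon bound from initial capital `1`, with the horizon sent to infinity by
continuity of measure from below. -/
theorem fairCoin_exceed_le {S : List Bool → ℚ} (hS : ∀ σ, |S σ| ≤ 1) {c : ℝ} (hc : 0 < c) :
    fairCoin {Y | ∃ m, c < tossCapital S Y m} ≤ ENNReal.ofReal c⁻¹ := by
  have hU : {Y : ℕ → Bool | ∃ m, c < tossCapital S Y m} =
      ⋃ r, {Y | ∃ m ≤ r, c < tossCapital S Y m} := by
    ext Y
    rw [Set.mem_iUnion]
    exact ⟨fun ⟨m, h⟩ => ⟨m, m, le_rfl, h⟩, fun ⟨_, m, _, h⟩ => ⟨m, h⟩⟩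
  have hmono : Monotone fun r => {Y : ℕ → Bool | ∃ m ≤ r, c < tossCapital S Y m} :=
    fun r r' hr Y ⟨m, hm, h⟩ => ⟨m, hm.trans hr, h⟩
  rw [hU, hmono.directed_le.measure_iUnion]
  refine iSup_le fun r => ?_
  have hdep : ∀ Y Z : ℕ → Bool, (∀ i < blockStart r, Y i = Z i) →
      Y ∈ {Y : ℕ → Bool | ∃ m ≤ r, c < tossCapital S Y m} →
      Z ∈ {Y : ℕ → Bool | ∃ m ≤ r, c < tossCapital S Y m} := by
    rintro Y Z h ⟨m, hm, hlt⟩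
    have : m * m ≤ blockStart r := Nat.mul_le_mul hm (by omega)
    exact ⟨m, hm, by rwa [← tossCapital_congr fun i hi => h i (by omega)]⟩
  refine (fairCoin_le_blockAverage hdep fun _ => false).trans (ENNReal.ofReal_le_ofReal ?_)
  simpa [blockStart, tossCapital] using blockAverage_exceed_le hS hc r 0 fun _ => false

/-! ### Martin-Löf tests -/

/-- The cylinders around the constant sequence `!b` are a Martin-Löf test. This keeps `p` away from
`0` and `1`. -/
theorem MartinLofRandom.exists_eq {α : ℕ → Bool} (hα : MartinLofRandom α) (b : Bool) :
    ∃ i, α i = b := by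
  by_contra! h
  refine hα (fun n => {Y | ∀ i < n, Y i = !b})
    ⟨{x | x.2 = initSeg (fun _ => !b) x.1}, ComputablePred.to_re ?_, fun n => ?_⟩ (fun n => ?_) ?_
  · have hw : Computable fun x : ℕ × List Bool => initSeg (fun _ => !b) x.1 :=
      computable_initSeg (X := fun _ _ => !b) (Computable.const _) Computable.fst
    refine ComputablePred.computable_iff.2
      ⟨_, Primrec.eq.decide.to_comp.comp Computable.snd hw, ?_⟩
    ext x
    exact decide_eq_true_iff.symm
  · ext Y
    constructor
    · exact fun hY => ⟨n, initSeg_congr hY⟩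
    · rintro ⟨k, hk⟩ i hi
      have hk : initSeg Y k = initSeg (fun _ => !b) n := hk
      have hlen := congrArg List.length hk
      simp only [length_initSeg] at hlen
      subst hlen
      rw [← extend_initSeg Y hi, hk, extend_initSeg _ hi]
  · exact (fairCoin_cylinder (fun _ => !b) n).le
  · exact Set.mem_iInter.2 fun n i _ => by
      have := h i
      cases b <;> simpa using this

section Computability

variable {β : Type*} [Primcodable β]

theorem computable_coinToss {X : β → ℕ → Bool} {k : β → ℕ} (hX : Computable₂ X)
    (hk : Computable k) : Computable fun x => coinToss (X x) (k x) :=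
  computable_decide_lt
    (computable_digits hX (computable_mul hk (computable_add hk (Computable.const 1))) hk)
    (computable_digits hX (Computable.const 0) hk)

end Computability

theorem tossCapital_eq_div {S : List Bool → ℚ} (hS : ∀ σ, |S σ| ≤ 1) {a b d : List Bool → ℕ}
    (h : ∀ σ, S σ = ((a σ : ℚ) - b σ) / (d σ + 1)) (X : ℕ → Bool) (n : ℕ) :
    tossCapital S X n =
      ((∏ k ∈ Finset.range n, factorNum (a (initSeg (coinToss X) k)) (b (initSeg (coinToss X) k))
        (d (initSeg (coinToss X) k)) (digits X 0 k) (2 ^ k) (coinToss X k) : ℕ) : ℝ) /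
      (∏ k ∈ Finset.range n, factorDen (d (initSeg (coinToss X) k)) (digits X 0 k) (2 ^ k)
        (coinToss X k) : ℕ) := by
  rw [Nat.cast_prod, Nat.cast_prod, ← Finset.prod_div_distrib]
  exact Finset.prod_congr rfl fun k _ =>
    factor_eq_div (h _) (hS _) digits_pos_of_coinToss (digits_lt _ _ _)

theorem MartinLofRandom.tossCapital_bounded {α : ℕ → Bool} (hα : MartinLofRandom α)
    {S : List Bool → ℚ} (hS : ∀ σ, |S σ| ≤ 1) (hcomp : ComputableRat S) :
    ∃ c, ∀ n, tossCapital S α n ≤ c := by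
  obtain ⟨a, b, d, ha, hb, hd, h⟩ := hcomp
  by_contra! hub
  refine hα (fun j => {Y | ∃ n, 2 ^ j < tossCapital S Y n})
    -- A word of length `l` determines the capital after `Nat.sqrt l` tosses, so the zeros in
    -- `extend` are never read; the set is even decidable, as the capitals are explicit fractions.
    ⟨{x | 2 ^ x.1 < tossCapital S (extend x.2) (Nat.sqrt x.2.length)}, ComputablePred.to_re ?_,
      fun j => ?_⟩ (fun j => ?_) (Set.mem_iInter.2 fun j => hub _)
  · have hlen : Computable fun x : ℕ × List Bool => Nat.sqrt x.2.length :=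
      Primrec.nat_sqrt.to_comp.comp (Computable.list_length.comp Computable.snd)
    have hX : Computable₂ fun (y : (ℕ × List Bool) × ℕ) i => extend y.1.2 i :=
      computable_extend (Computable.snd.comp (Computable.fst.comp Computable.fst)) Computable.snd
    have hQ : Computable₂ fun (y : (ℕ × List Bool) × ℕ) i => coinToss (extend y.1.2) i :=
      computable_coinToss (X := fun z : ((ℕ × List Bool) × ℕ) × ℕ => extend z.1.1.2)
        (hX.comp (Computable.fst.comp Computable.fst) Computable.snd) Computable.snd
    have hσ : Computable fun y : (ℕ × List Bool) × ℕ =>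
        initSeg (coinToss (extend y.1.2)) y.2 := computable_initSeg hQ Computable.snd
    have hbit : Computable fun y : (ℕ × List Bool) × ℕ => coinToss (extend y.1.2) y.2 :=
      computable_coinToss hX Computable.snd
    have hP : Computable fun y : (ℕ × List Bool) × ℕ => digits (extend y.1.2) 0 y.2 :=
      computable_digits hX (Computable.const 0) Computable.snd
    have hL : Computable fun y : (ℕ × List Bool) × ℕ => 2 ^ y.2 := computable_two_pow Computable.snd
    have hnum := computable_prod_range (Computable.to₂ (computable_factorNum (ha.comp hσ)
      (hb.comp hσ) (hd.comp hσ) hP hL hbit)) hlen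
    have hden := computable_prod_range (Computable.to₂ (computable_factorDen (hd.comp hσ) hP hL
      hbit)) hlen
    refine ComputablePred.computable_iff.2 ⟨_, computable_decide_lt
      (computable_mul (computable_two_pow Computable.fst) hden) hnum, ?_⟩
    ext x
    rw [decide_eq_true_iff]
    have hpos : 0 < ∏ k ∈ Finset.range (Nat.sqrt x.2.length),
        factorDen (d (initSeg (coinToss (extend x.2)) k)) (digits (extend x.2) 0 k) (2 ^ k)
          (coinToss (extend x.2) k) :=
      Finset.prod_pos fun k _ => factorDen_pos digits_pos_of_coinToss (digits_lt _ _ _)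
    change 2 ^ x.1 < tossCapital S _ _ ↔ _
    rw [tossCapital_eq_div hS h, lt_div_iff₀ (by exact_mod_cast hpos)]
    exact_mod_cast Iff.rfl
  · ext Y
    constructor
    · rintro ⟨n, hn⟩
      refine ⟨n * n, ?_⟩
      change _ < tossCapital S _ (Nat.sqrt (initSeg Y (n * n)).length)
      rw [length_initSeg, Nat.sqrt_eq]
      rwa [tossCapital_congr fun i hi => extend_initSeg Y hi]
    · rintro ⟨k, hk⟩
      change _ < tossCapital S _ (Nat.sqrt (initSeg Y k).length) at hk
      rw [length_initSeg, tossCapital_congr fun i hi =>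
        extend_initSeg Y (hi.trans_le (Nat.sqrt_le k))] at hk
      exact ⟨_, hk⟩
  · refine (fairCoin_exceed_le hS (by positivity)).trans (le_of_eq ?_)
    rw [← inv_pow, ENNReal.ofReal_pow (by norm_num)]
    congr 1
    rw [ENNReal.ofReal_inv_of_pos (by norm_num)]
    simp

/-! ### Approximation of the real `0.X` by its initial segments -/

theorem summable_binaryExpansion (X : ℕ → Bool) :
    Summable fun i : ℕ => (if X i then (1 : ℝ) else 0) * (1 / 2) ^ (i + 1) := by
  refine Summable.of_nonneg_of_le (fun i => ?_) (fun i => ?_)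
    ((summable_nat_add_iff 1).2 summable_geometric_two)
  · split_ifs <;> positivity
  · split_ifs <;> simp

theorem tossBias_eq_sum (X : ℕ → Bool) (k : ℕ) :
    tossBias X k = ∑ i ∈ Finset.range k, (if X i then (1 : ℝ) else 0) * (1 / 2) ^ (i + 1) := by
  induction k with
  | zero => simp [tossBias, digits]
  | succ k ih =>
    rw [Finset.sum_range_succ, ← ih, tossBias, tossBias, digits, zero_add]
    cases X k <;> · push_cast; simp; field_simp; ring

theorem tossBias_le_toReal (X : ℕ → Bool) (k : ℕ) : tossBias X k ≤ toReal X := by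
  rw [tossBias_eq_sum]
  exact (summable_binaryExpansion X).sum_le_tsum _ fun i _ => by split_ifs <;> positivity

theorem toReal_sub_tossBias_le (X : ℕ → Bool) (k : ℕ) :
    toReal X - tossBias X k ≤ (1 / 2) ^ k := by
  have hs := summable_binaryExpansion X
  have hg : Summable fun i : ℕ => (1 / 2 : ℝ) ^ k / 2 / 2 ^ i := summable_geometric_two' _
  rw [tossBias_eq_sum, toReal, ← hs.sum_add_tsum_nat_add k, add_sub_cancel_left,
    ← tsum_geometric_two' ((1 / 2 : ℝ) ^ k)]
  refine ((summable_nat_add_iff k).2 hs).tsum_le_tsum (fun i => ?_) hg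
  have : (1 / 2 : ℝ) ^ (i + k + 1) = (1 / 2) ^ k / 2 / 2 ^ i := by
    rw [pow_add, pow_add, div_div, one_div_pow (n := i)]
    field_simp
  rw [← this]
  split_ifs <;> simp

theorem MartinLofRandom.toReal_pos {α : ℕ → Bool} (hα : MartinLofRandom α) : 0 < toReal α := by
  obtain ⟨i, hi⟩ := hα.exists_eq true
  refine lt_of_lt_of_le ?_ (tossBias_le_toReal α (i + 1))
  have : 0 < digits α 0 (i + 1) := by simp [digits, hi]
  unfold tossBias
  positivity

theorem MartinLofRandom.toReal_lt_one {α : ℕ → Bool} (hα : MartinLofRandom α) :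
    toReal α < 1 := by
  obtain ⟨i, hi⟩ := hα.exists_eq false
  have h1 := toReal_sub_tossBias_le α (i + 1)
  -- A last digit `0` leaves room for two units in the last place, while the tail of the expansion
  -- is worth at most one.
  have h2 : digits α 0 (i + 1) + 2 ≤ 2 ^ (i + 1) := by
    have := digits_lt α 0 i
    simp only [digits, zero_add, hi, Bool.toNat_false, pow_succ]
    omega
  have h3 : (digits α 0 (i + 1) : ℝ) + 2 ≤ 2 ^ (i + 1) := by exact_mod_cast h2
  have h4 : tossBias α (i + 1) + 2 * (1 / 2) ^ (i + 1) ≤ 1 := by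
    rw [tossBias, one_div_pow]
    push_cast
    rw [mul_one_div, ← add_div, div_le_one (by positivity)]
    exact h3
  have : (0 : ℝ) < (1 / 2) ^ (i + 1) := by positivity
  linarith

/-! ### Capitals are computable from the oracle -/

/-- The numerator of the capital at the word `x.1`, where the stakes are `(a - b) / (d + 1)` and the
binary digits of the bias are the bits of `x.2`. -/
def capitalNum (a b d : List Bool × List Bool → ℕ) (x : List Bool × List Bool) : ℕ :=
  ∏ k ∈ Finset.range x.1.length,
    factorNum (a (initSeg (extend x.1) k, x.2)) (b (initSeg (extend x.1) k, x.2))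
      (d (initSeg (extend x.1) k, x.2)) (digits (extend x.2) 0 x.2.length) (2 ^ x.2.length)
      (extend x.1 k)

/-- The denominator that belongs to `capitalNum`. -/
def capitalDen (d : List Bool × List Bool → ℕ) (x : List Bool × List Bool) : ℕ :=
  ∏ k ∈ Finset.range x.1.length,
    factorDen (d (initSeg (extend x.1) k, x.2)) (digits (extend x.2) 0 x.2.length)
      (2 ^ x.2.length) (extend x.1 k)

section Computability

theorem computable_extend_fst :
    Computable fun y : (List Bool × List Bool) × ℕ => extend y.1.1 y.2 :=
  computable_extend (Computable.fst.comp Computable.fst) Computable.snd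

theorem computable_prefix_pair : Computable fun y : (List Bool × List Bool) × ℕ =>
    (initSeg (extend y.1.1) y.2, y.1.2) :=
  (computable_initSeg (X := fun y : (List Bool × List Bool) × ℕ => extend y.1.1)
    (computable_extend (Computable.fst.comp (Computable.fst.comp Computable.fst)) Computable.snd)
    Computable.snd).pair (Computable.snd.comp Computable.fst)

theorem computable_length_snd :
    Computable fun y : (List Bool × List Bool) × ℕ => y.1.2.length :=
  Computable.list_length.comp (Computable.snd.comp Computable.fst)

theorem computable_digits_snd : Computable fun y : (List Bool × List Bool) × ℕ =>
    digits (extend y.1.2) 0 y.1.2.length :=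
  computable_digits (X := fun y : (List Bool × List Bool) × ℕ => extend y.1.2)
    (computable_extend (Computable.snd.comp (Computable.fst.comp Computable.fst)) Computable.snd)
    (Computable.const 0) computable_length_snd

theorem computable_capitalNum {a b d : List Bool × List Bool → ℕ} (ha : Computable a)
    (hb : Computable b) (hd : Computable d) : Computable (capitalNum a b d) := by
  have ha' := ha.comp computable_prefix_pair
  have hb' := hb.comp computable_prefix_pair
  have hd' := hd.comp computable_prefix_pair
  have h := computable_factorNum ha' hb' hd' computable_digits_snd
    (computable_two_pow computable_length_snd) computable_extend_fst
  have hlen : Computable fun x : List Bool × List Bool => x.1.length :=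
    Computable.list_length.comp Computable.fst
  exact computable_prod_range h.to₂ hlen

theorem computable_capitalDen {d : List Bool × List Bool → ℕ} (hd : Computable d) :
    Computable (capitalDen d) := by
  have hd' := hd.comp computable_prefix_pair
  have h := computable_factorDen hd' computable_digits_snd
    (computable_two_pow computable_length_snd) computable_extend_fst
  have hlen : Computable fun x : List Bool × List Bool => x.1.length :=
    Computable.list_length.comp Computable.fst
  exact computable_prod_range h.to₂ hlen

end Computability

/-- The capital is evaluated exactly at a truncated bias, and `abs_capital_sub_le` controls the
error. The stakes may read a prefix of `A`, which covers both oracle-free stakes and the gambler who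
knows the tosses. -/
theorem computableRealFrom_capital {A : ℕ → Bool} (h0 : 0 < toReal A) (h1 : toReal A < 1)
    {S : List Bool → ℚ} (hS : ∀ σ, |S σ| ≤ 1) {u : ℕ → ℕ} (hu : Computable u) (hmono : Monotone u)
    {a b d : List Bool × List Bool → ℕ} (ha : Computable a) (hb : Computable b)
    (hd : Computable d) (h : ∀ σ m, u σ.length ≤ m → S σ =
      ((a (σ, initSeg A m) : ℚ) - b (σ, initSeg A m)) / (d (σ, initSeg A m) + 1)) :
    ComputableRealFrom A (capital S (toReal A)) := by
  -- With `B = 2 ^ e`, the bias and its truncations to at least `e` digits lie in `[1 / B, 1 - 1 /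
  -- B]`; the half leaves room for the truncation error.
  obtain ⟨e, he⟩ := exists_pow_lt_of_lt_one (show 0 < min (toReal A / 2) (1 - toReal A) from
    lt_min (by linarith) (by linarith)) (show (1 / 2 : ℝ) < 1 by norm_num)
  obtain ⟨he0, he1⟩ := lt_min_iff.1 he
  have hB : (1 / 2 : ℝ) ^ e = 1 / 2 ^ e := one_div_pow _ _
  -- Enough bits for the stakes, for the lower bound on the truncated bias, and for the error: with
  -- `l` the word length, `l * B ^ (l + 1)` is at most `2 ^ (l + e * (l + 1))`.
  let prec (x : List Bool × ℕ) : ℕ :=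
    u x.1.length + e + (x.2 + x.1.length + e * (x.1.length + 1))
  have hword : Computable fun x : (List Bool × ℕ) × List Bool => (x.1.1, x.2) :=
    (Computable.fst.comp Computable.fst).pair Computable.snd
  have hnum : Computable fun x : (List Bool × ℕ) × List Bool => capitalNum a b d (x.1.1, x.2) :=
    (computable_capitalNum ha hb hd).comp hword
  -- `ComputableRealFrom` adds `1` to the denominator.
  have hden : Computable fun x : (List Bool × ℕ) × List Bool => capitalDen d (x.1.1, x.2) - 1 :=
    computable_sub ((computable_capitalDen hd).comp hword) (Computable.const 1)
  have hprec : Computable prec := by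
    have hl : Computable fun x : List Bool × ℕ => x.1.length :=
      Computable.list_length.comp Computable.fst
    exact computable_add (computable_add (hu.comp hl) (Computable.const e))
      (computable_add (computable_add Computable.snd hl) (computable_mul (Computable.const e)
        (computable_add hl (Computable.const 1))))
  refine ⟨_, fun _ => 0, _, computableIn_of_initSeg hnum hprec, ComputableIn.const 0,
    computableIn_of_initSeg hden hprec,
    fun σ n => ?_⟩
  set m := prec (σ, n) with hm
  dsimp only
  have hme : e ≤ m := by simp only [hm, prec]; omega
  have hclose := toReal_sub_tossBias_le A m
  have hle := tossBias_le_toReal A m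
  have hsmall : (1 / 2 : ℝ) ^ m ≤ (1 / 2) ^ e := pow_le_pow_of_le_one (by norm_num) (by norm_num) hme
  have hq : 1 / 2 ^ e ≤ tossBias A m := by linarith
  have hq0 : 0 < digits A 0 m := by
    have : 0 < tossBias A m := lt_of_lt_of_le (by positivity) hq
    by_contra hn
    simp [tossBias, Nat.eq_zero_of_not_pos hn] at this
  have hdig : digits (extend (initSeg A m)) 0 m = digits A 0 m :=
    digits_congr fun i _ hi => extend_initSeg A (by omega)
  have hdenpos : 0 < capitalDen d (σ, initSeg A m) := by
    refine Finset.prod_pos fun k _ => factorDen_pos (fun _ => ?_) (digits_lt _ _ _)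
    simp only [length_initSeg, hdig, hq0]
  have hval : capital S (tossBias A m) (initSeg (extend σ) σ.length) =
      (capitalNum a b d (σ, initSeg A m) : ℝ) / capitalDen d (σ, initSeg A m) := by
    simp only [capitalNum, capitalDen]
    rw [capital_initSeg, Nat.cast_prod, Nat.cast_prod, ← Finset.prod_div_distrib]
    refine Finset.prod_congr rfl fun k hk => ?_
    simp only [length_initSeg, hdig]
    refine factor_eq_div (h _ _ ?_) (hS _) (fun _ => hq0) (digits_lt _ _ _)
    have := hmono (Finset.mem_range.1 hk).le
    simp only [length_initSeg, hm, prec]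
    omega
  have hcast : ((capitalDen d (σ, initSeg A m) - 1 : ℕ) : ℝ) + 1 = capitalDen d (σ, initSeg A m) := by
    rw [Nat.cast_sub hdenpos]; simp
  rw [hcast, Nat.cast_zero, sub_zero, ← hval]
  nth_rw 1 [← initSeg_extend σ]
  refine (abs_capital_sub_le (B := 2 ^ e) (one_le_pow₀ one_le_two) (by linarith)
    (by linarith) hq (by linarith) hS _ _).trans ?_
  rw [abs_of_nonneg (sub_nonneg.2 hle)]
  calc (σ.length : ℝ) * (2 ^ e) ^ (σ.length + 1) * (toReal A - tossBias A m)
      ≤ 2 ^ σ.length * (2 ^ e) ^ (σ.length + 1) *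
          (1 / 2) ^ (n + σ.length + e * (σ.length + 1)) := by
        gcongr
        · exact_mod_cast Nat.lt_two_pow_self.le
        · refine hclose.trans (pow_le_pow_of_le_one (by norm_num) (by norm_num) ?_)
          simp only [hm, prec]; omega
    _ = (1 / 2) ^ n := by
        rw [← pow_mul, pow_add, pow_add, one_div_pow 2 σ.length, one_div_pow 2 (e * _)]
        field_simp

theorem ComputablyRandom.hippocratic {A X : ℕ → Bool} (h0 : 0 < toReal A) (h1 : toReal A < 1)
    (hX : ComputablyRandom A X) : HippocraticComputablyRandom (toReal A) X := by
  rintro S hS ⟨a, b, d, ha, hb, hd, h⟩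
  exact hX _ (isMartingale_capital h0 h1 hS) (computableRealFrom_capital h0 h1 hS
    (Computable.const 0) monotone_const (ha.comp Computable.fst) (hb.comp Computable.fst)
    (hd.comp Computable.fst) fun σ _ _ => h σ)

/-! ### Randomness properties of the sequence of coin tosses -/

theorem computableFrom_coinToss (A : ℕ → Bool) : ComputableFrom A (coinToss A) := by
  have hsq : Computable fun n : ℕ => (n + 1) * (n + 1) :=
    computable_mul (computable_add Computable.id (Computable.const 1))
      (computable_add Computable.id (Computable.const 1))
  have hf : Computable fun x : ℕ × List Bool => coinToss (extend x.2) x.1 :=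
    computable_coinToss (X := fun x : ℕ × List Bool => extend x.2)
      (computable_extend (Computable.snd.comp Computable.fst) Computable.snd) Computable.fst
  have := computableIn_of_initSeg (A := A) hf hsq
  have heq : coinToss A = fun n => coinToss (extend (initSeg A ((n + 1) * (n + 1)))) n :=
    funext fun n => coinToss_congr (Nat.lt_succ_self n) fun i hi => (extend_initSeg A hi).symm
  rw [ComputableFrom, heq]
  exact this

/-- Staking everything on the correct outcome multiplies the capital by `1 / p` or `1 / (1 - p)`,
hence by at least `1 / max p (1 - p) > 1`, at every toss. -/
theorem not_computablyRandom_coinToss {A : ℕ → Bool} (h0 : 0 < toReal A) (h1 : toReal A < 1) :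
    ¬ ComputablyRandom A (coinToss A) := by
  intro hQ
  set p := toReal A
  let S (σ : List Bool) : ℚ := if coinToss A σ.length then 1 else -1
  have hS : ∀ σ, |S σ| ≤ 1 := fun σ => by
    simp only [S]; split_ifs <;> simp
  have htoss : Computable fun x : List Bool × List Bool => coinToss (extend x.2) x.1.length :=
    computable_coinToss (X := fun x : List Bool × List Bool => extend x.2)
      (computable_extend (Computable.snd.comp Computable.fst) Computable.snd)
      (Computable.list_length.comp Computable.fst)
  have hsq : Computable fun n : ℕ => (n + 1) * (n + 1) :=
    computable_mul (computable_add Computable.id (Computable.const 1))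
      (computable_add Computable.id (Computable.const 1))
  have hreal : ComputableRealFrom A (capital S p) := by
    refine computableRealFrom_capital h0 h1 hS hsq
      (fun m n hmn => Nat.mul_le_mul (by omega) (by omega))
      ((Primrec.dom_bool Bool.toNat).to_comp.comp htoss)
      ((Primrec.dom_bool fun b => (!b).toNat).to_comp.comp htoss)
      (Computable.const 0) fun σ m hm => ?_
    rw [coinToss_congr (Y := A) (Nat.lt_succ_self _) fun i hi => extend_initSeg A (hi.trans_le hm)]
    simp only [S]
    cases coinToss A σ.length <;> simp
  obtain ⟨c, hc⟩ := hQ _ (isMartingale_capital h0 h1 hS) hreal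
  have hp : 0 < max p (1 - p) := lt_max_of_lt_left h0
  have hr : 1 < 1 / max p (1 - p) := by
    rw [one_lt_div hp]
    exact max_lt h1 (by linarith)
  obtain ⟨n, hn⟩ := pow_unbounded_of_one_lt c hr
  refine (hc ⟨n, rfl⟩).not_gt (hn.trans_le ?_)
  have hfac : ∀ k, 1 / max p (1 - p) ≤ factor p (S (initSeg (coinToss A) k)) (coinToss A k) := by
    intro k
    simp only [S, length_initSeg]
    cases coinToss A k
    · simpa [factor] using inv_anti₀ (sub_pos.2 h1) (le_max_right p (1 - p))
    · simpa [factor] using inv_anti₀ h0 (le_max_left p (1 - p))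
  calc (1 / max p (1 - p)) ^ n = ∏ k ∈ Finset.range n, 1 / max p (1 - p) := by simp
    _ ≤ _ := Finset.prod_le_prod (fun _ _ => by positivity) fun k _ => hfac k
    _ = _ := (capital_initSeg S p _ n).symm

theorem hippocratic_coinToss {α : ℕ → Bool} (hα : MartinLofRandom α) :
    HippocraticComputablyRandom (toReal α) (coinToss α) := by
  intro S hS hcomp
  obtain ⟨c, hc⟩ := hα.tossCapital_bounded hS hcomp
  have h1 := hα.toReal_lt_one
  set p := toReal α
  have hp : 0 < 1 - p := sub_pos.2 h1
  have hc0 : 0 ≤ c := (tossCapital_nonneg hS α 0).trans (hc 0)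
  -- The exponential bounds the product of the correction factors, by `1 + x ≤ exp x` and `∑ 2 ^
  -- (-k) = 2`.
  refine ⟨Real.exp (2 / (1 - p)) * c, ?_⟩
  rintro _ ⟨n, rfl⟩
  have hsum : ∑ k ∈ Finset.range n, (1 / 2 : ℝ) ^ k ≤ 2 := by
    refine (summable_geometric_two.sum_le_tsum _ fun _ _ => ?_).trans_eq tsum_geometric_two
    positivity
  have hprod : ∏ k ∈ Finset.range n, (1 + (1 / 2 : ℝ) ^ k / (1 - p)) ≤ Real.exp (2 / (1 - p)) := by
    calc _ ≤ ∏ k ∈ Finset.range n, Real.exp ((1 / 2 : ℝ) ^ k / (1 - p)) :=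
          Finset.prod_le_prod (fun _ _ => by positivity) fun k _ => by
            rw [add_comm]; exact Real.add_one_le_exp _
      _ = Real.exp ((∑ k ∈ Finset.range n, (1 / 2 : ℝ) ^ k) / (1 - p)) := by
          rw [← Real.exp_sum, Finset.sum_div]
      _ ≤ _ := by gcongr
  calc capital S p (initSeg (coinToss α) n)
      = ∏ k ∈ Finset.range n, factor p (S (initSeg (coinToss α) k)) (coinToss α k) :=
        capital_initSeg S p _ n
    _ ≤ ∏ k ∈ Finset.range n, ((1 + (1 / 2 : ℝ) ^ k / (1 - p)) *
          factor (tossBias α k) (S (initSeg (coinToss α) k)) (coinToss α k)) :=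
        Finset.prod_le_prod
          (fun k _ => factor_nonneg hα.toReal_pos.le h1.le (hS _) _)
          fun k _ => factor_le_of_bias_le (tossBias_nonneg α k) (tossBias_le_toReal α k) h1
            (toReal_sub_tossBias_le α k) (hS _) fun h => by
              have := digits_pos_of_coinToss h
              unfold tossBias
              positivity
    _ = (∏ k ∈ Finset.range n, (1 + (1 / 2 : ℝ) ^ k / (1 - p))) * tossCapital S α n := by
        rw [Finset.prod_mul_distrib, tossCapital]
    _ ≤ _ := mul_le_mul hprod (hc n) (tossCapital_nonneg hS α n) (Real.exp_pos _).le

/-! ### A machine for the coin tosses -/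

namespace OracleTM

theorem step_of_out {M : OracleTM} {A : ℕ → Bool} {n : ℕ} {c : M.Cfg} {b : Bool}
    (h : M.out c.state = some b) : M.step A n c = c := by
  simp [step, h]

theorem OutputsWithin.mono {M : OracleTM} {A : ℕ → Bool} {n t t' : ℕ} {b : Bool}
    (h : M.OutputsWithin A n t b) (htt' : t ≤ t') : M.OutputsWithin A n t' b := by
  obtain ⟨s, rfl⟩ := Nat.exists_eq_add_of_le' htt'
  rw [OutputsWithin, Function.iterate_add_apply, Function.iterate_fixed (step_of_out h)]
  exact h

end OracleTM

namespace TossMachine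

open OracleTM

/-- The transitions of the machine for the coin tosses, which has one work tape. In state `0` it
copies oracle bits to the work tape, one for each stroke of the input; in state `1` it returns to
the beginning of the work tape; in state `2` it moves over the word on the work tape while the
oracle head advances, which is repeated for each stroke of the input; in state `3` it compares the
word with the bits of the oracle. -/
def trans : Fin 4 → Option Bool → Bool → Option Bool →
    (Bool ⊕ Fin 4) × SignType × SignType × Option Bool × SignType
  | 0, o, true, _ => (.inr 0, 1, 1, o, 1)
  | 0, _, false, w => (.inr 1, 0, -1, w, -1)
  | 1, _, _, some a => (.inr 1, 0, 0, some a, -1)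
  | 1, _, _, none => (.inr 2, 0, 0, none, 1)
  | 2, _, false, w => (.inr 3, 0, 0, w, 0)
  | 2, _, true, some a => (.inr 2, 1, 0, some a, 1)
  | 2, _, true, none => (.inr 1, 0, -1, none, -1)
  | 3, _, _, none => (.inl false, 0, 0, none, 0)
  | 3, o, _, some a => if o = some a then (.inr 3, 1, 0, some a, 1) else (.inl a, 0, 0, some a, 0)

/-- The machine for the coin tosses. -/
def machine : OracleTM where
  State := Bool ⊕ Fin 4
  finite_State := inferInstance
  Γ := Option Bool
  finite_Γ := inferInstance
  blank := none
  k := 1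
  start := .inr 0
  out := Sum.elim some fun _ => none
  δ q o i w := match q with
    | .inl b => (.inl b, 0, 0, fun j => (w j, 0))
    | .inr s => let r := trans s o i (w 0); (r.1, r.2.1, r.2.2.1, fun _ => r.2.2.2)

/-- A configuration of the machine. -/
def cfg (q : Bool ⊕ Fin 4) (o i w : ℤ) (T : ℤ → Option Bool) : machine.Cfg where
  state := q
  oraclePos := o
  inputPos := i
  workPos := fun _ => w
  work := fun _ => T

/-- The work tape with the first `n` bits of `A`. -/
def prefixTape (A : ℕ → Bool) (n : ℕ) (z : ℤ) : Option Bool :=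
  if 0 ≤ z ∧ z < n then some (A z.toNat) else none

variable {A : ℕ → Bool} {n : ℕ}

theorem step_cfg (s : Fin 4) (o i w : ℤ) (T : ℤ → Option Bool) :
    machine.step A n (cfg (.inr s) o i w T) =
      cfg (trans s (oracleTape A o) (inputTape n i) (T w)).1
        (o + (trans s (oracleTape A o) (inputTape n i) (T w)).2.1)
        (i + (trans s (oracleTape A o) (inputTape n i) (T w)).2.2.1)
        (w + (trans s (oracleTape A o) (inputTape n i) (T w)).2.2.2.2)
        (Function.update T w (trans s (oracleTape A o) (inputTape n i) (T w)).2.2.2.1) :=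
  rfl

/-- Covers every transition that rewrites the scanned symbol unchanged; only loading alters the
tape. -/
theorem step_cfg_of_eq {s : Fin 4} {o i w : ℤ} {T : ℤ → Option Bool} {a b : Option Bool} {c : Bool}
    {q : Bool ⊕ Fin 4} {mo mi mw : SignType} (ho : oracleTape A o = a) (hi : inputTape n i = c)
    (hT : T w = b) (h : trans s a c b = (q, mo, mi, b, mw)) :
    machine.step A n (cfg (.inr s) o i w T) = cfg q (o + mo) (i + mi) (w + mw) T := by
  rw [step_cfg, ho, hi, hT, h]
  dsimp only
  rw [← hT, Function.update_eq_self]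

theorem oracleTape_natCast (j : ℕ) : oracleTape A j = some (A j) := by simp [oracleTape]

theorem prefixTape_natCast {j : ℕ} (h : j < n) : prefixTape A n j = some (A j) := by
  simp [prefixTape, h]

theorem prefixTape_self : prefixTape A n n = none := by simp [prefixTape]

theorem iterate_load {j : ℕ} (hj : j ≤ n) :
    (machine.step A n)^[j] machine.init = cfg (.inr 0) j j j (prefixTape A j) := by
  induction j with
  | zero =>
    have : prefixTape A 0 = fun _ => none := by
      ext1 z; simp only [prefixTape, Nat.cast_zero]; rw [if_neg (by omega)]
    rw [this]
    rfl
  | succ j ih =>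
    have hi : inputTape n j = true := by simp [inputTape]; omega
    rw [Function.iterate_succ_apply', ih (by omega), step_cfg, hi, oracleTape_natCast]
    simp only [trans, SignType.coe_one]
    have : Function.update (prefixTape A j) j (some (A j)) = prefixTape A (j + 1) := by
      ext1 z
      by_cases hz : z = j
      · subst hz; rw [Function.update_self, prefixTape_natCast (Nat.lt_succ_self j)]
      · rw [Function.update_of_ne hz, prefixTape, prefixTape]
        congr 1
        exact propext (by push_cast; omega)
    rw [this]
    push_cast
    rfl

theorem iterate_back (o i : ℤ) {j : ℕ} (hj : j ≤ n) :
    (machine.step A n)^[j + 1] (cfg (.inr 1) o i (j - 1) (prefixTape A n)) =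
      cfg (.inr 2) o i 0 (prefixTape A n) := by
  induction j with
  | zero =>
    have hT : prefixTape A n (-1) = none := by simp [prefixTape]
    rw [Function.iterate_one, Nat.cast_zero, zero_sub, step_cfg_of_eq rfl rfl hT rfl]
    simp
  | succ j ih =>
    rw [Function.iterate_succ_apply, Nat.cast_succ, add_sub_cancel_right,
      step_cfg_of_eq rfl rfl (prefixTape_natCast hj) rfl]
    simpa [← sub_eq_add_neg] using ih (by omega)

theorem iterate_forth (o : ℤ) {i j : ℕ} (hi : i < n) (hj : j ≤ n) :
    (machine.step A n)^[j] (cfg (.inr 2) o i 0 (prefixTape A n)) =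
      cfg (.inr 2) (o + j) i j (prefixTape A n) := by
  induction j with
  | zero => simp
  | succ j ih =>
    have hi : inputTape n i = true := by simp [inputTape, hi]
    rw [Function.iterate_succ_apply', ih (by omega),
      step_cfg_of_eq rfl hi (prefixTape_natCast hj) rfl]
    simp [add_assoc]

/-- One pass over the stored word advances the oracle head by `n` and consumes one stroke. The `n`
rounds add `n * n` to the `n` cells passed while loading, which gives `blockStart n`. -/
theorem iterate_round (o : ℤ) {i : ℕ} (hi : i < n) :
    (machine.step A n)^[2 * n + 2] (cfg (.inr 2) o i 0 (prefixTape A n)) =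
      cfg (.inr 2) (o + n) (i - 1) 0 (prefixTape A n) := by
  have hi' : inputTape n i = true := by simp [inputTape, hi]
  rw [show 2 * n + 2 = n + 1 + (1 + n) by ring, Function.iterate_add_apply _ (n + 1),
    Function.iterate_add_apply _ 1, iterate_forth o hi le_rfl, Function.iterate_one,
    step_cfg_of_eq rfl hi' prefixTape_self rfl]
  simpa [← sub_eq_add_neg] using iterate_back (A := A) (o + n) (i - 1) (le_refl n)

theorem iterate_rounds (o : ℤ) {j : ℕ} (hj : j ≤ n) :
    (machine.step A n)^[j * (2 * n + 2)] (cfg (.inr 2) o (j - 1) 0 (prefixTape A n)) =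
      cfg (.inr 2) (o + j * n) (-1) 0 (prefixTape A n) := by
  induction j generalizing o with
  | zero => simp
  | succ j ih =>
    rw [Nat.succ_mul, Function.iterate_add_apply, Nat.cast_succ, add_sub_cancel_right,
      iterate_round o hj, ih (o + n) (by omega)]
    congr 1
    ring

/-- At the first difference the block is smaller exactly when the stored bit is `1`, so that bit is
the answer; full agreement gives `false`, as the comparison is strict. -/
theorem exists_iterate_compare (m : ℕ) (i : ℤ) {j : ℕ} (hj : j ≤ n)
    (h : digits A m j = digits A 0 j) :
    ∃ t ≤ n - j + 1, machine.out ((machine.step A n)^[t]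
      (cfg (.inr 3) (m + j : ℕ) i j (prefixTape A n))).state =
        some (decide (digits A m n < digits A 0 n)) := by
  induction hj using Nat.decreasingInduction with
  | self =>
    refine ⟨1, by omega, ?_⟩
    rw [Function.iterate_one, step_cfg_of_eq rfl rfl prefixTape_self rfl, h]
    simp [cfg, machine]
  | of_succ j hj ih =>
    by_cases hb : A (m + j) = A j
    · obtain ⟨t, ht, hout⟩ := ih (by rw [digits, digits, h, hb, zero_add])
      refine ⟨t + 1, by omega, ?_⟩
      rw [Function.iterate_succ_apply, step_cfg_of_eq (oracleTape_natCast _) rfl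
        (prefixTape_natCast hj) (q := .inr 3) (mo := 1) (mi := 0) (mw := 1) (by simp [trans, hb])]
      simpa [add_assoc] using hout
    · refine ⟨1, by omega, ?_⟩
      rw [Function.iterate_one, step_cfg_of_eq (oracleTape_natCast _) rfl
        (prefixTape_natCast hj) (q := .inl (A j)) (mo := 0) (mi := 0) (mw := 0)
        (by simp [trans, hb])]
      change some (A j) = _
      cases hA : A j
      · have : digits A 0 n < digits A m n := digits_lt_of_le hj (by
          cases hm : A (m + j) <;> simp_all [digits])
        simp [this.le]
      · have : digits A m n < digits A 0 n := digits_lt_of_le hj (by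
          cases hm : A (m + j) <;> simp_all [digits])
        simp [this]

theorem outputsWithin_machine (A : ℕ → Bool) (n : ℕ) :
    machine.OutputsWithin A n (2 * n ^ 2 + 5 * n + 4) (coinToss A n) := by
  obtain ⟨t, ht, hout⟩ := exists_iterate_compare (A := A) (n := n) (blockStart n) (-1)
    (Nat.zero_le n) rfl
  have hload : inputTape n n = false := by simp [inputTape]
  have hdone : inputTape n (-1) = false := by simp [inputTape]
  -- From right to left: load, turn, return, `n` rounds, switch to comparing, compare.
  have hrun : (machine.step A n)^[t + (1 + (n * (2 * n + 2) + (n + 1 + (1 + n))))] machine.init =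
      (machine.step A n)^[t] (cfg (.inr 3) (blockStart n + 0 : ℕ) (-1) (0 : ℕ) (prefixTape A n)) := by
    rw [Function.iterate_add_apply, Function.iterate_add_apply _ 1,
      Function.iterate_add_apply _ (n * _), Function.iterate_add_apply _ (n + 1),
      Function.iterate_add_apply _ 1, iterate_load le_rfl,
      Function.iterate_one, step_cfg_of_eq rfl hload prefixTape_self rfl]
    simp only [SignType.coe_zero, SignType.coe_neg_one, add_zero, ← sub_eq_add_neg]
    rw [iterate_back _ _ le_rfl, iterate_rounds _ le_rfl, step_cfg_of_eq rfl hdone rfl rfl]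
    simp [blockStart]
    congr 2
    ring
  have : machine.OutputsWithin A n (t + (1 + (n * (2 * n + 2) + (n + 1 + (1 + n)))))
      (coinToss A n) := by
    rw [OutputsWithin, hrun]
    exact hout
  refine this.mono ?_
  have : n * (2 * n + 2) = 2 * n ^ 2 + 2 * n := by ring
  omega

end TossMachine

theorem polyTimeComputableFrom_coinToss (A : ℕ → Bool) : PolyTimeComputableFrom A (coinToss A) :=
  ⟨TossMachine.machine, 2 * Polynomial.X ^ 2 + 5 * Polynomial.X + 4, fun n => by
    simpa using TossMachine.outputsWithin_machine A n⟩

end Hippocratic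

theorem mainTheorem1 (α : ℕ → Bool) (hα : Hippocratic.MartinLofRandom α) :
    (∃ Q : ℕ → Bool,
      Hippocratic.PolyTimeComputableFrom α Q ∧
      Hippocratic.ComputableFrom α Q ∧
      Hippocratic.HippocraticComputablyRandom (Hippocratic.toReal α) Q ∧
      ¬ Hippocratic.ComputablyRandom α Q) ∧
    {X : ℕ → Bool | Hippocratic.ComputablyRandom α X} ⊂
      {X : ℕ → Bool | Hippocratic.HippocraticComputablyRandom (Hippocratic.toReal α) X} := by
  have h0 := hα.toReal_pos
  have h1 := hα.toReal_lt_one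
  have hQ := Hippocratic.hippocratic_coinToss hα
  have hQ' := Hippocratic.not_computablyRandom_coinToss h0 h1
  exact ⟨⟨Hippocratic.coinToss α, Hippocratic.polyTimeComputableFrom_coinToss α,
    Hippocratic.computableFrom_coinToss α, hQ, hQ'⟩,
    fun X hX => Hippocratic.ComputablyRandom.hippocratic h0 h1 hX, fun h => hQ' (h hQ)⟩
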